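/- Consider the following D2D (device-to-device) network, seen from a typical user at the origin of $\mathbb{R}^2$. The D2D users form a homogeneous Poisson point process of density $\lambda_d>0$ on $\mathbb{R}^2$. Independently of the positions and of each other, each user is half-duplex (HD) with probability $\mathcal P_{HD}$ and full-duplex (FD) with probability $\mathcal P_{FD}$, where $\mathcal P_{HD},\mathcal P_{FD}\ge 0$ and $\mathcal P_{HD}+\mathcal P_{FD}=1$; an HD user is a transmitter or a receiver with probability $\tfrac12$ each, and every FD user transmits. Thus the HD transmitters and the FD users have densities $\lambda_{HD}=\tfrac12\lambda_d\mathcal P_{HD}$ and $\lambda_{FD}=\lambda_d\mathcal P_{FD}$. All transmit with power $P_d>0$, the path-loss exponent is $\alpha>2$, and the channel gains $h_x$ from the users $x$ to the origin are i.i.d. exponential with mean one, independent of positions and types. Let $T\in\{HD,FD\}$ with $\mathcal P_T>0$, and let $\Phi_T$ be the set of HD transmitters if $T=HD$ and of FD users if $T=FD$. The typical user is paired with the nearest point $x_0$ of $\Phi_T$ (nearest-neighbour pairing, $n=1$), at distance $r_d=\|x_0\|$; the same-type interference is $I_T=\sum_{x\in\Phi_T\setminus\{x_0\}}P_d h_x\|x\|^{-\alpha}$,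 and $\mathcal L_{I_T}^{T}(s)=\mathbb E[e^{-sI_T}\mid r_d]$ is its Laplace transform given the link distance $r_d$. Then $I_T<\infty$ almost surely, and for almost every value $r_d>0$ the following holds. For all $s\ge 0$, $$\mathcal L_{I_T}^{T}(s)=\exp\Big(-2\pi\lambda_T\int_{r_d}^{\infty}\frac{sP_dx^{-\alpha}}{1+sP_dx^{-\alpha}}\,x\,dx\Big),$$ and if $\alpha=4$, then for all $\beta\ge 0$, $$\mathcal L_{I_T}^{T}\Big(\frac{\beta r_d^4}{P_d}\Big)=\exp\big(-\pi\lambda_T r_d^2\sqrt\beta\,\arctan\sqrt\beta\big).$$ -/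

import Mathlib

open MeasureTheory ProbabilityTheory Set
open scoped ENNReal NNReal

noncomputable section

/-- The Euclidean plane. -/
abbrev Plane : Type := EuclideanSpace ℝ (Fin 2)

/-- The number of points of the random sequence `X` (with multiplicity) that lie in `B`. -/
def pointCount {Ω : Type*} (X : ℕ → Ω → Plane) (B : Set Plane) (ω : Ω) : ℕ∞ :=
  {i | X i ω ∈ B}.encard

/-- The points `X 0, X 1, …` form a Poisson point process with intensity measure `Λ`: the number
of points in a Borel set `B` of finite intensity is Poisson with mean `Λ B`, and the numbers of
points in finitely many pairwise disjoint Borel sets are independent. (The points are enumerated by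
`ℕ`, so this is for processes with almost surely infinitely many points, as when `Λ` is infinite.)
-/
structure IsPoissonPointProcess {Ω : Type*} [MeasurableSpace Ω] (X : ℕ → Ω → Plane)
    (Λ : Measure Plane) (μ : Measure Ω) : Prop where
  measurable : ∀ i, Measurable (X i)
  hasLaw_count : ∀ B : Set Plane, MeasurableSet B → Λ B ≠ ∞ →
    HasLaw (pointCount X B) ((poissonMeasure (Λ B).toNNReal).map (fun k : ℕ => (k : ℕ∞))) μ
  indep_count : ∀ (n : ℕ) (B : Fin n → Set Plane), (∀ j, MeasurableSet (B j)) →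
    Pairwise (fun j k => Disjoint (B j) (B k)) → iIndepFun (fun j => pointCount X (B j)) μ

/-- The role of a D2D user: half-duplex transmitter, half-duplex receiver, or full-duplex
transceiver. -/
inductive Role : Type
  | hdTx
  | hdRx
  | fd

instance : MeasurableSpace Role := ⊤

/-- The probability of each role when a D2D user is half-duplex with probability `pHD` and
full-duplex with probability `pFD`, and a half-duplex user transmits or receives with probability
`1/2` each. -/
def roleProb (pHD pFD : ℝ) : Role → ℝ
  | Role.hdTx => pHD / 2
  | Role.hdRx => pHD / 2
  | Role.fd => pFD

/-- The D2D network seen from a typical user at the origin. The positions `X i` of the D2D users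
form a homogeneous Poisson process of density `lam` in the plane; user `i` has the role `role i`,
and `h i` is the gain of its (Rayleigh fading) channel to the origin. The pairs `(role i, h i)` are
independent of each other and of the positions, and `role i` is independent of `h i`. -/
structure IsD2DNetwork {Ω : Type*} [MeasurableSpace Ω] (X : ℕ → Ω → Plane)
    (role : ℕ → Ω → Role) (h : ℕ → Ω → ℝ) (lam pHD pFD : ℝ) (μ : Measure Ω) : Prop where
  poisson : IsPoissonPointProcess X (ENNReal.ofReal lam • volume) μ
  measurable_role : ∀ i, Measurable (role i)
  measurable_gain : ∀ i, Measurable (h i)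
  role_law : ∀ i t, μ {ω | role i ω = t} = ENNReal.ofReal (roleProb pHD pFD t)
  gain_law : ∀ i, HasLaw (h i) (expMeasure 1) μ
  indep_role_gain : ∀ i, IndepFun (role i) (h i) μ
  indep_marks : iIndepFun (fun i ω => (role i ω, h i ω)) μ
  indep_position : IndepFun (fun ω i => X i ω) (fun ω i => (role i ω, h i ω)) μ

/-- User `i` is the nearest user of role `t` to the origin, i.e. the transmitter with which the
typical user is paired. -/
def IsNearest {Ω : Type*} (X : ℕ → Ω → Plane) (role : ℕ → Ω → Role) (t : Role) (ω : Ω)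
    (i : ℕ) : Prop :=
  role i ω = t ∧ ∀ j, role j ω = t → ‖X i ω‖ ≤ ‖X j ω‖

/-- The link distance `r_d`: the distance from the origin to the nearest user of role `t`. -/
def linkDist {Ω : Type*} (X : ℕ → Ω → Plane) (role : ℕ → Ω → Role) (t : Role) (ω : Ω) : ℝ :=
  sInf ((fun i => ‖X i ω‖) '' {i | role i ω = t})

open Classical in
/-- The power received at the origin from user `i` as an interferer of role `t`: it is
`P h_i ‖X_i‖^(-α)` if `i` has role `t` and is not the paired (nearest) transmitter. -/
def interferenceTerm {Ω : Type*} (X : ℕ → Ω → Plane) (role : ℕ → Ω → Role) (h : ℕ → Ω → ℝ)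
    (P α : ℝ) (t : Role) (ω : Ω) (i : ℕ) : ℝ :=
  if role i ω = t ∧ ¬ IsNearest X role t ω i then P * h i ω * ‖X i ω‖ ^ (-α) else 0

/-- The interference from the users of role `t`. -/
def interference {Ω : Type*} (X : ℕ → Ω → Plane) (role : ℕ → Ω → Role) (h : ℕ → Ω → ℝ)
    (P α : ℝ) (t : Role) (ω : Ω) : ℝ :=
  ∑' i, interferenceTerm X role h P α t ω i

/-- The Laplace transform `s ↦ E[exp (-s I) | r_d = r]` of the interference from the users of role
`t`, given that the typical user is paired with the nearest user of role `t` at distance `r`. -/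
def interferenceLaplace {Ω : Type*} [MeasurableSpace Ω] (X : ℕ → Ω → Plane)
    (role : ℕ → Ω → Role) (h : ℕ → Ω → ℝ) (P α : ℝ) (t : Role) (μ : Measure Ω)
    [IsFiniteMeasure μ] (r s : ℝ) : ℝ :=
  ∫ y, Real.exp (-s * y) ∂(condDistrib (interference X role h P α t) (linkDist X role t) μ r)

end

noncomputable section

open Filter Topology

/-! ### The Poisson distribution -/

/-! Fix a role `t`. Let c be the density of its users, R the link distance, I the interference, J_b
the power received from users of role `t` outside the disc of radius b, and L(r) the claimed Laplace
transform at link distance r.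

The generating functional of the Poisson process, with roles and gains averaged out as independent
marks, gives for a ≤ b that E[exp(-s J_b); no user of role `t` within a] = exp(-cπa²) L(b)
(`integral_void_mul_exp`). Subtracting the case a = b yields E[exp(-s J_b); a < R ≤ b] = (exp(-cπa²)
- exp(-cπb²)) L(b). On this event I = J_b unless the annulus between a and b holds at least two
users, which has probability at most (λπ(b² - a²))². So E[exp(-s I); a < R ≤ b] equals the same
product up to an error of second order in b - a (`abs_integral_linkDist_mem_Ioc_sub_le`).

Hence the measure A ↦ E[exp(-s I); R ∈ A] has on (0, ∞) the density 2πcr exp(-cπr²) L(r). The case s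
= 0 is the density of R itself, and the quotient of the two densities is the conditional Laplace
transform for almost every r (`ae_integral_condDistrib_eq`). Rational s together with continuity in
s give one null set for all s. For α = 4 the exponent has an elementary primitive.

The generating functional is computed for simple functions from the independence of counts, and
extended by L¹ approximation with an error controlled by Campbell's formula. -/

theorem integral_pow_poissonMeasure (r : ℝ≥0) (z : ℝ) :
    ∫ k, z ^ k ∂(poissonMeasure r) = Real.exp (-(1 - z) * r) := by
  rw [integral_poissonMeasure]
  have h := (NormedSpace.expSeries_div_hasSum_exp (r * z : ℝ)).mul_left (Real.exp (-r))
  rw [← Real.exp_eq_exp_ℝ, ← Real.exp_add] at h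
  convert h.tsum_eq using 1
  · congr 1 with n
    rw [smul_eq_mul, mul_pow]; ring
  · congr 1; ring

theorem lintegral_natCast_poissonMeasure (r : ℝ≥0) :
    ∫⁻ k, (k : ℝ≥0∞) ∂(poissonMeasure r) = r := by
  have key : HasSum (fun n : ℕ => Real.exp (-r) * r ^ n / n.factorial * n) (r : ℝ) := by
    rw [← hasSum_nat_add_iff' 1]
    have h := (hasSum_one_poissonMeasure r).mul_left (r : ℝ)
    have h0 : (r : ℝ) - ∑ i ∈ Finset.range 1, Real.exp (-r) * r ^ i / i.factorial * i = r * 1 := by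
      simp
    rw [h0]
    have hf : (fun n : ℕ => Real.exp (-r) * r ^ (n + 1) / (n + 1).factorial * ((n + 1 : ℕ) : ℝ))
        = fun n : ℕ => (r : ℝ) * (Real.exp (-r) * r ^ n / n.factorial) := by
      ext n
      rw [Nat.factorial_succ, pow_succ]; push_cast; field_simp
    rw [hf]
    exact h
  rw [poissonMeasure, lintegral_sum_measure]
  simp_rw [lintegral_smul_measure, lintegral_dirac, smul_eq_mul]
  rw [← ENNReal.ofReal_coe_nnreal]
  conv_rhs => rw [← key.tsum_eq,
    ENNReal.ofReal_tsum_of_nonneg (fun n => by positivity) key.summable]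
  congr 1 with n
  rw [ENNReal.ofReal_mul (by positivity), ENNReal.ofReal_natCast]

/-- The bound follows from 1 - (1 + r) exp(-r) ≤ 1 - (1 + r)(1 - r). Its being quadratic is what
makes two users in a thin annulus negligible when dividing by the width. -/
theorem poissonMeasure_real_two_le (r : ℝ≥0) :
    (poissonMeasure r).real {k | 2 ≤ k} ≤ (r : ℝ) ^ 2 := by
  have h : ({k | 2 ≤ k} : Set ℕ) = ({0} ∪ {1})ᶜ := by
    ext k; simp; omega
  rw [h, probReal_compl_eq_one_sub (by measurability),
    measureReal_union (by simp) (by measurability),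
    poissonMeasure_real_singleton, poissonMeasure_real_singleton]
  have h1 : 1 - (r : ℝ) ≤ Real.exp (-r) := Real.one_sub_le_exp_neg _
  have h2 : (0 : ℝ) ≤ r := r.2
  simp only [pow_zero, Nat.factorial, pow_one, Nat.cast_one]
  nlinarith

/-! ### Counts of a Poisson point process -/

theorem coe_pointCount {Ω : Type*} (X : ℕ → Ω → Plane) (B : Set Plane) (ω : Ω) :
    ((pointCount X B ω : ℕ∞) : ℝ≥0∞) = ∑' i, B.indicator 1 (X i ω) := by
  rw [pointCount, ← ENNReal.tsum_set_one, tsum_subtype {i | X i ω ∈ B} (fun _ => (1 : ℝ≥0∞))]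
  congr 1

/-- Telescoping: the factors are exchanged one at a time, the others being bounded by 1. -/
theorem abs_prod_sub_prod_le {ι : Type*} (s : Finset ι) (a b : ι → ℝ)
    (ha : ∀ i, |a i| ≤ 1) (hb : ∀ i, |b i| ≤ 1) :
    |∏ i ∈ s, a i - ∏ i ∈ s, b i| ≤ ∑ i ∈ s, |a i - b i| := by
  classical
  induction s using Finset.induction_on with
  | empty => simp
  | insert i s hi ih =>
    rw [Finset.prod_insert hi, Finset.prod_insert hi, Finset.sum_insert hi]
    have h1 : |∏ i ∈ s, b i| ≤ 1 := by
      rw [Finset.abs_prod]; exact Finset.prod_le_one (fun _ _ => abs_nonneg _) fun j _ => hb j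
    calc |a i * ∏ j ∈ s, a j - b i * ∏ j ∈ s, b j|
        = |(a i - b i) * ∏ j ∈ s, b j + a i * (∏ j ∈ s, a j - ∏ j ∈ s, b j)| := by
          congr 1; ring
      _ ≤ |a i - b i| * |∏ j ∈ s, b j| + |a i| * |∏ j ∈ s, a j - ∏ j ∈ s, b j| := by
          rw [← abs_mul, ← abs_mul]; exact abs_add_le _ _
      _ ≤ |a i - b i| * 1 + 1 * ∑ j ∈ s, |a j - b j| := by
          gcongr
          exact ha i
      _ = _ := by ring

section Poisson

variable {Ω : Type*} [MeasurableSpace Ω] {μ : Measure Ω} {X : ℕ → Ω → Plane} {Λ : Measure Plane}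

namespace IsPoissonPointProcess

theorem integral_pow_count (hX : IsPoissonPointProcess X Λ μ) {B : Set Plane}
    (hB : MeasurableSet B) (hΛ : Λ B ≠ ∞) (z : ℝ) :
    ∫ ω, z ^ (pointCount X B ω).toNat ∂μ = Real.exp (-(1 - z) * Λ.real B) := by
  have h := (hX.hasLaw_count B hB hΛ).integral_comp (f := fun k : ℕ∞ => z ^ k.toNat)
    (Measurable.of_discrete.aestronglyMeasurable)
  simp only [Function.comp_def] at h
  rw [h, integral_map .of_discrete .of_discrete]
  simp only [ENat.toNat_natCast]
  rw [integral_pow_poissonMeasure]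
  rfl

theorem ae_finite (hX : IsPoissonPointProcess X Λ μ) {B : Set Plane}
    (hB : MeasurableSet B) (hΛ : Λ B ≠ ∞) : ∀ᵐ ω ∂μ, {i | X i ω ∈ B}.Finite := by
  have h : ∀ᵐ ω ∂μ, pointCount X B ω ≠ ⊤ := by
    rw [(hX.hasLaw_count B hB hΛ).ae_iff (p := fun k => k ≠ ⊤) .of_discrete,
      ae_map_iff .of_discrete .of_discrete]
    exact ae_of_all _ fun k => ENat.natCast_ne_top k
  filter_upwards [h] with ω hω
  exact Set.encard_ne_top_iff.1 hω

theorem measureReal_two_le_count (hX : IsPoissonPointProcess X Λ μ) {B : Set Plane}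
    (hB : MeasurableSet B) (hΛ : Λ B ≠ ∞) :
    μ.real {ω | 2 ≤ pointCount X B ω} ≤ Λ.real B ^ 2 := by
  rw [(hX.hasLaw_count B hB hΛ).measureReal_eq (p := fun k => 2 ≤ k) .of_discrete,
    map_measureReal_apply .of_discrete .of_discrete]
  refine le_trans (le_of_eq ?_) (poissonMeasure_real_two_le _)
  congr 1
  ext k
  simp only [mem_preimage, mem_ofPred_eq]
  exact_mod_cast Iff.rfl

theorem tsum_map_apply (hX : IsPoissonPointProcess X Λ μ) {B : Set Plane}
    (hB : MeasurableSet B) (hΛ : Λ B ≠ ∞) : ∑' i, μ.map (X i) B = Λ B := by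
  have h1 : ∫⁻ ω, ((pointCount X B ω : ℕ∞) : ℝ≥0∞) ∂μ = Λ B := by
    rw [(hX.hasLaw_count B hB hΛ).lintegral_comp (f := fun k : ℕ∞ => (k : ℝ≥0∞))
      Measurable.of_discrete.aemeasurable, lintegral_map .of_discrete .of_discrete]
    simp only [ENat.toENNReal_coe]
    rw [lintegral_natCast_poissonMeasure, ENNReal.coe_toNNReal hΛ]
  simp_rw [coe_pointCount] at h1
  have hm : ∀ i, Measurable fun ω => B.indicator (1 : Plane → ℝ≥0∞) (X i ω) := fun i =>
    (measurable_one.indicator hB).comp (hX.measurable i)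
  rw [lintegral_tsum fun i => (hm i).aemeasurable] at h1
  rw [← h1]
  congr 1 with i
  rw [Measure.map_apply (hX.measurable i) hB, ← lintegral_indicator_one (hX.measurable i hB)]
  rfl

/-- The mean count is known only on sets of finite intensity; σ-finiteness exhausts every Borel set
by such sets. -/
theorem sum_map_eq (hX : IsPoissonPointProcess X Λ μ) [SigmaFinite Λ] :
    Measure.sum (fun i => μ.map (X i)) = Λ := by
  ext B hB
  have hmono : Monotone fun n => B ∩ spanningSets Λ n := fun m n hmn =>
    inter_subset_inter_right _ (monotone_spanningSets Λ hmn)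
  have hU : (⋃ n, B ∩ spanningSets Λ n) = B := by
    rw [← inter_iUnion, iUnion_spanningSets, inter_univ]
  rw [← hU, hmono.measure_iUnion, hmono.measure_iUnion]
  congr 1 with n
  have hm : MeasurableSet (B ∩ spanningSets Λ n) := hB.inter (measurableSet_spanningSets Λ n)
  rw [Measure.sum_apply _ hm, hX.tsum_map_apply hm]
  exact ((measure_mono inter_subset_right).trans_lt (measure_spanningSets_lt_top Λ n)).ne

/-- Campbell's formula. -/
theorem tsum_lintegral (hX : IsPoissonPointProcess X Λ μ) [SigmaFinite Λ] {f : Plane → ℝ≥0∞}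
    (hf : Measurable f) : ∑' i, ∫⁻ ω, f (X i ω) ∂μ = ∫⁻ x, f x ∂Λ := by
  conv_rhs => rw [← hX.sum_map_eq, lintegral_sum_measure]
  congr 1 with i
  rw [lintegral_map hf (hX.measurable i)]

/-! ### The probability generating functional -/

/-- Grouping the points by the value c of `v` turns the full product into finitely many independent
factors (1 - c)^N, with N the Poisson count of the level set. Almost surely only finitely many
points have `v` nonzero, so the partial products are eventually constant. -/
theorem tendsto_integral_prod_simpleFunc [IsProbabilityMeasure μ]
    (hX : IsPoissonPointProcess X Λ μ)
    (v : SimpleFunc Plane ℝ) (h0 : ∀ x, 0 ≤ v x) (h1 : ∀ x, v x ≤ 1) (hv : Integrable v Λ) :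
    Tendsto (fun n => ∫ ω, ∏ i ∈ Finset.range n, (1 - v (X i ω)) ∂μ) atTop
      (𝓝 (Real.exp (-∫ x, v x ∂Λ))) := by
  classical
  -- The level 0 is discarded: it contributes factors 1, but its level set may have infinite
  -- intensity.
  set R : Finset ℝ := v.range.filter (· ≠ 0) with hR
  have hfin : ∀ c ∈ R, Λ (v ⁻¹' {c}) ≠ ∞ := fun c hc =>
    (SimpleFunc.integrable_iff.1 hv c (Finset.mem_filter.1 hc).2).ne
  have hlim : ∫ ω, ∏ c ∈ R, (1 - c) ^ (pointCount X (v ⁻¹' {c}) ω).toNat ∂μ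
      = Real.exp (-∫ x, v x ∂Λ) := by
    set e := R.equivFin.symm
    have hpr : ∀ F : ℝ → ℝ, ∏ c ∈ R, F c = ∏ j, F (e j) := fun F => by
      rw [← Finset.prod_coe_sort R F, ← Equiv.prod_comp e]
    have hind := hX.indep_count R.card (fun j => v ⁻¹' {(e j : ℝ)})
      (fun j => v.measurableSet_fiber _) (fun j k hjk => by
        refine Disjoint.preimage _ (disjoint_singleton.2 fun h => hjk ?_)
        exact e.injective (Subtype.ext h))
    simp_rw [hpr]
    rw [hind.integral_fun_prod_comp (f := fun j (k : ℕ∞) => (1 - (e j : ℝ)) ^ k.toNat)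
      (fun j => (hX.hasLaw_count _ (v.measurableSet_fiber _) (hfin _ (e j).2)).aemeasurable)
      (fun j => Measurable.of_discrete.aestronglyMeasurable)]
    rw [← SimpleFunc.integral_eq_integral v hv, SimpleFunc.integral_eq_sum_filter,
      ← Finset.sum_neg_distrib, Real.exp_sum]
    rw [hpr fun c => Real.exp (-(Λ.real (v ⁻¹' {c}) • c))]
    refine Finset.prod_congr rfl fun j _ => ?_
    rw [hX.integral_pow_count (v.measurableSet_fiber _) (hfin _ (e j).2)]
    congr 1
    rw [smul_eq_mul]; ring
  rw [← hlim]
  refine tendsto_integral_of_dominated_convergence (fun _ => 1) (fun n => ?_)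
    (integrable_const _) (fun n => ?_) ?_
  · have hm : Measurable fun ω => ∏ i ∈ Finset.range n, (1 - v (X i ω)) :=
      Finset.measurable_prod _ fun i _ =>
        measurable_const.sub (v.measurable.comp (hX.measurable i))
    exact hm.aestronglyMeasurable
  · refine ae_of_all _ fun ω => ?_
    rw [Real.norm_eq_abs, abs_of_nonneg
      (Finset.prod_nonneg fun i _ => sub_nonneg.2 (h1 _))]
    exact Finset.prod_le_one (fun i _ => sub_nonneg.2 (h1 _))
      fun i _ => sub_le_self _ (h0 _)
  · have hae : ∀ᵐ ω ∂μ, ∀ c ∈ R, {i | X i ω ∈ v ⁻¹' {c}}.Finite :=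
      (ae_ball_iff R.countable_toSet).2 fun c hc =>
        hX.ae_finite (v.measurableSet_fiber _) (hfin c hc)
    filter_upwards [hae] with ω hω
    have hF : {i | v (X i ω) ≠ 0}.Finite := by
      refine (R.finite_toSet.biUnion hω).subset fun i hi => ?_
      simp only [mem_iUnion]
      exact ⟨v (X i ω), Finset.mem_filter.2 ⟨v.mem_range_self _, hi⟩, rfl⟩
    have hprod : ∏ c ∈ R, (1 - c) ^ (pointCount X (v ⁻¹' {c}) ω).toNat
        = ∏ i ∈ hF.toFinset, (1 - v (X i ω)) := by
      rw [← Finset.prod_fiberwise_of_maps_to (s := hF.toFinset) (t := R)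
        (g := fun i => v (X i ω))
        (fun i hi => Finset.mem_filter.2 ⟨v.mem_range_self _, hF.mem_toFinset.1 hi⟩)]
      refine Finset.prod_congr rfl fun c hc => ?_
      rw [Finset.prod_congr rfl (g := fun _ => 1 - c)
        (fun i hi => by rw [(Finset.mem_filter.1 hi).2]), Finset.prod_const]
      congr 1
      rw [pointCount, ← Set.ncard_def, ← Set.ncard_coe_finset]
      congr 1
      ext i
      simp only [mem_preimage, mem_singleton_iff, mem_ofPred_eq, Finset.coe_filter,
        Finite.mem_toFinset]
      exact ⟨fun h => ⟨h ▸ (Finset.mem_filter.1 hc).2, h⟩, fun h => h.2⟩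
    rw [hprod]
    refine tendsto_const_nhds.congr' ?_
    obtain ⟨N, hN⟩ := hF.toFinset.exists_nat_subset_range
    filter_upwards [eventually_ge_atTop N] with n hn
    refine Finset.prod_subset (hN.trans (Finset.range_mono hn)) fun i _ hi => ?_
    have : v (X i ω) = 0 := by simpa using hi
    rw [this, sub_zero]

/-- Campbell's formula makes the bound independent of `n`, so approximation of `u` commutes with the
limit over points. -/
theorem abs_integral_prod_sub_le [IsProbabilityMeasure μ] [SigmaFinite Λ]
    (hX : IsPoissonPointProcess X Λ μ) {u v : Plane → ℝ} (hu : Measurable u) (hv : Measurable v)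
    (hu' : ∀ x, u x ∈ Icc (0 : ℝ) 1) (hv' : ∀ x, v x ∈ Icc (0 : ℝ) 1)
    (huv : Integrable (fun x => u x - v x) Λ) (n : ℕ) :
    |∫ ω, ∏ i ∈ Finset.range n, (1 - u (X i ω)) ∂μ
      - ∫ ω, ∏ i ∈ Finset.range n, (1 - v (X i ω)) ∂μ| ≤ ∫ x, |u x - v x| ∂Λ := by
  have hbd : ∀ {w : Plane → ℝ}, (∀ x, w x ∈ Icc (0 : ℝ) 1) → ∀ x, |1 - w x| ≤ 1 :=
    fun hw x => abs_le.2 ⟨by linarith [(hw x).2], by linarith [(hw x).1]⟩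
  have hint : ∀ {w : Plane → ℝ}, Measurable w → (∀ x, w x ∈ Icc (0 : ℝ) 1) →
      Integrable (fun ω => ∏ i ∈ Finset.range n, (1 - w (X i ω))) μ := by
    intro w hw hw'
    refine Integrable.of_bound (C := 1) (Finset.measurable_prod _ fun i _ =>
        measurable_const.sub (hw.comp (hX.measurable i))).aestronglyMeasurable
      (ae_of_all _ fun ω => ?_)
    rw [Real.norm_eq_abs, Finset.abs_prod]
    exact Finset.prod_le_one (fun _ _ => abs_nonneg _) fun i _ => hbd hw' _
  have hi : ∀ i, Integrable (fun ω => |u (X i ω) - v (X i ω)|) μ := fun i => by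
    refine Integrable.of_bound (C := 1)
      (((hu.comp (hX.measurable i)).sub (hv.comp (hX.measurable i))).norm).aestronglyMeasurable
      (ae_of_all _ fun ω => ?_)
    rw [Real.norm_eq_abs, abs_abs]
    exact abs_le.2 ⟨by linarith [(hu' (X i ω)).1, (hv' (X i ω)).2],
      by linarith [(hu' (X i ω)).2, (hv' (X i ω)).1]⟩
  rw [← integral_sub (hint hu hu') (hint hv hv')]
  calc |∫ ω, (∏ i ∈ Finset.range n, (1 - u (X i ω)) - ∏ i ∈ Finset.range n, (1 - v (X i ω))) ∂μ|
      ≤ ∫ ω, |∏ i ∈ Finset.range n, (1 - u (X i ω)) - ∏ i ∈ Finset.range n, (1 - v (X i ω))| ∂μ :=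
        abs_integral_le_integral_abs
    _ ≤ ∫ ω, ∑ i ∈ Finset.range n, |u (X i ω) - v (X i ω)| ∂μ := by
        refine integral_mono ((hint hu hu').sub (hint hv hv')).abs
          (integrable_finsetSum _ fun i _ => hi i) fun ω => ?_
        refine (abs_prod_sub_prod_le _ _ _ (fun i => hbd hu' _) (fun i => hbd hv' _)).trans
          (Finset.sum_le_sum fun i _ => le_of_eq ?_)
        rw [abs_sub_comm]; congr 1; ring
    _ = ∑ i ∈ Finset.range n, ∫ ω, |u (X i ω) - v (X i ω)| ∂μ :=
        integral_finsetSum _ fun i _ => hi i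
    _ ≤ ∫ x, |u x - v x| ∂Λ := by
        rw [integral_eq_lintegral_of_nonneg_ae (f := fun x => |u x - v x|)
          (ae_of_all _ fun x => abs_nonneg _) (hu.sub hv).norm.aestronglyMeasurable]
        have hm : Measurable fun x => ENNReal.ofReal |u x - v x| :=
          (hu.sub hv).norm.ennreal_ofReal
        have hfin : ∫⁻ x, ENNReal.ofReal |u x - v x| ∂Λ ≠ ∞ := by
          have := huv.abs.lintegral_lt_top
          exact this.ne
        rw [← hX.tsum_lintegral hm] at hfin ⊢
        simp_rw [fun i => integral_eq_lintegral_of_nonneg_ae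
          (ae_of_all μ fun ω => abs_nonneg (u (X i ω) - v (X i ω))) (hi i).aestronglyMeasurable]
        rw [← ENNReal.toReal_sum fun i _ => ENNReal.ne_top_of_tsum_ne_top hfin i]
        exact ENNReal.toReal_mono hfin (ENNReal.sum_le_tsum _)

/-- The probability generating functional of a Poisson point process. -/
theorem tendsto_integral_prod [IsProbabilityMeasure μ] [SigmaFinite Λ]
    (hX : IsPoissonPointProcess X Λ μ) {u : Plane → ℝ} (hu : Measurable u)
    (hu' : ∀ x, u x ∈ Icc (0 : ℝ) 1) (hui : Integrable u Λ) :
    Tendsto (fun n => ∫ ω, ∏ i ∈ Finset.range n, (1 - u (X i ω)) ∂μ) atTop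
      (𝓝 (Real.exp (-∫ x, u x ∂Λ))) := by
  have h0 : (0 : ℝ) ∈ Icc (0 : ℝ) 1 := by simp
  set v : ℕ → SimpleFunc Plane ℝ := fun m => SimpleFunc.approxOn u hu (Icc 0 1) 0 h0 m
  have hv' : ∀ m x, v m x ∈ Icc (0 : ℝ) 1 := fun m x => SimpleFunc.approxOn_mem hu h0 m x
  have hvi : ∀ m, Integrable (v m) Λ := fun m =>
    SimpleFunc.integrable_approxOn hu hui h0 (integrable_zero _ _ _) m
  have hL1 : Tendsto (fun m => ∫ x, |v m x - u x| ∂Λ) atTop (𝓝 0) := by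
    have h := SimpleFunc.tendsto_approxOn_L1_enorm hu h0 (μ := Λ)
      (ae_of_all _ fun x => subset_closure (hu' x)) (by simpa using hui.2)
    have h2 := (ENNReal.tendsto_toReal ENNReal.zero_ne_top).comp h
    refine h2.congr fun m => ?_
    rw [integral_eq_lintegral_of_nonneg_ae (f := fun x => |v m x - u x|)
      (ae_of_all _ fun x => abs_nonneg _) ((hvi m).sub hui).abs.aestronglyMeasurable]
    simp only [Function.comp]
    congr 2 with x
    rw [Real.enorm_eq_ofReal_abs]
  have hexp : Tendsto (fun m => Real.exp (-∫ x, v m x ∂Λ)) atTop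
      (𝓝 (Real.exp (-∫ x, u x ∂Λ))) := by
    refine (Real.continuous_exp.tendsto _).comp (Tendsto.neg ?_)
    rw [tendsto_iff_norm_sub_tendsto_zero]
    refine squeeze_zero (fun _ => norm_nonneg _) (fun m => ?_) hL1
    rw [← integral_sub (hvi m) hui]
    exact abs_integral_le_integral_abs
  rw [Metric.tendsto_atTop]
  intro ε hε
  -- The approximation `m` is fixed before `N`: replacing `u` by `v m` costs less than ε/3 for every
  -- `n` at once.
  obtain ⟨m, hm1, hm2⟩ := ((hL1.eventually (gt_mem_nhds (show 0 < ε / 3 by positivity))).and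
    (Metric.tendsto_nhds.1 hexp (ε / 3) (by positivity))).exists
  obtain ⟨N, hN⟩ := Metric.tendsto_atTop.1 (hX.tendsto_integral_prod_simpleFunc (v m)
    (fun x => (hv' m x).1) (fun x => (hv' m x).2) (hvi m)) (ε / 3) (by positivity)
  refine ⟨N, fun n hn => ?_⟩
  have h1 := hX.abs_integral_prod_sub_le (v m).measurable hu (hv' m) hu' ((hvi m).sub hui) n
  have h2 := hN n hn
  rw [Real.dist_eq] at h2 hm2 ⊢
  rw [abs_lt] at *
  rw [abs_le] at h1
  constructor <;> linarith [h1.1, h1.2, h2.1, h2.2, hm2.1, hm2.2]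

end IsPoissonPointProcess

end Poisson

/-! ### The exponential distribution -/

/-- Tilting the rate 1 density by exp(-cx) gives 1 / (1 + c) times the density of rate 1 + c.
Negative `c` is allowed because c = -1/2 later yields the finite mean, through x ≤ 2 exp(x/2). -/
theorem lintegral_exp_neg_mul_expMeasure {c : ℝ} (hc : -1 < c) :
    ∫⁻ x, ENNReal.ofReal (Real.exp (-c * x)) ∂(expMeasure 1) = ENNReal.ofReal (1 / (1 + c)) := by
  have hc' : 0 < 1 + c := by linarith
  have hm : Measurable fun x => exponentialPDF 1 x :=
    (measurable_exponentialPDFReal 1).ennreal_ofReal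
  have hm' : Measurable fun x => exponentialPDF (1 + c) x :=
    (measurable_exponentialPDFReal (1 + c)).ennreal_ofReal
  change ∫⁻ x, _ ∂(volume.withDensity (exponentialPDF 1)) = _
  rw [lintegral_withDensity_eq_lintegral_mul _ hm (by fun_prop)]
  have h : ∀ x, (exponentialPDF 1 * fun x => ENNReal.ofReal (Real.exp (-c * x))) x
      = ENNReal.ofReal (1 / (1 + c)) * exponentialPDF (1 + c) x := by
    intro x
    rw [Pi.mul_apply]
    rcases lt_or_ge x 0 with hx | hx
    · rw [exponentialPDF_of_neg hx, exponentialPDF_of_neg hx, zero_mul, mul_zero]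
    · rw [exponentialPDF_of_nonneg hx, exponentialPDF_of_nonneg hx,
        ← ENNReal.ofReal_mul (by positivity), ← ENNReal.ofReal_mul (by positivity),
        one_mul, ← Real.exp_add, ← mul_assoc, one_div_mul_cancel hc'.ne', one_mul]
      congr 2; ring_nf
  simp_rw [h]
  rw [lintegral_const_mul _ hm', lintegral_exponentialPDF_eq_one hc', mul_one]

theorem integral_exp_neg_mul_expMeasure {c : ℝ} (hc : -1 < c) :
    ∫ x, Real.exp (-c * x) ∂(expMeasure 1) = 1 / (1 + c) := by
  rw [integral_eq_lintegral_of_nonneg_ae (ae_of_all _ fun x => (Real.exp_pos _).le)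
    (by fun_prop), lintegral_exp_neg_mul_expMeasure hc, ENNReal.toReal_ofReal]
  have : 0 < 1 + c := by linarith
  positivity

theorem ae_nonneg_expMeasure : ∀ᵐ x ∂(expMeasure 1), 0 ≤ x := by
  change ∀ᵐ x ∂(volume.withDensity (exponentialPDF 1)), 0 ≤ x
  rw [ae_withDensity_iff (show Measurable (exponentialPDF 1) from
    (measurable_exponentialPDFReal 1).ennreal_ofReal)]
  refine ae_of_all _ fun x hx => ?_
  by_contra h
  exact hx (exponentialPDF_of_neg (not_le.1 h))

theorem lintegral_ofReal_expMeasure_ne_top :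
    ∫⁻ x, ENNReal.ofReal x ∂(expMeasure 1) ≠ ∞ := by
  have h1 : ∫⁻ x, ENNReal.ofReal x ∂(expMeasure 1)
      ≤ ∫⁻ x, 2 * ENNReal.ofReal (Real.exp (-(-1 / 2) * x)) ∂(expMeasure 1) := by
    refine lintegral_mono fun x => ?_
    rw [← ENNReal.ofReal_ofNat 2, ← ENNReal.ofReal_mul (by norm_num)]
    refine ENNReal.ofReal_le_ofReal ?_
    have := Real.add_one_le_exp (-(-1 / 2) * x)
    linarith
  refine ne_top_of_le_ne_top ?_ h1
  rw [lintegral_const_mul _ (by fun_prop), lintegral_exp_neg_mul_expMeasure (by norm_num)]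
  exact ENNReal.mul_ne_top (by norm_num) ENNReal.ofReal_ne_top

/-! ### The exponent of the Laplace transform -/

/-- The radial integral in the exponent of the Laplace transform of the interference from
outside the disc of radius `r`. -/
def interferenceExponent (P α s r : ℝ) : ℝ :=
  ∫ x in Ioi r, s * P * x ^ (-α) / (1 + s * P * x ^ (-α)) * x

theorem continuousOn_exponentIntegrand {P α s : ℝ} (hP : 0 < P) (hs : 0 ≤ s) :
    ContinuousOn (fun x : ℝ => s * P * x ^ (-α) / (1 + s * P * x ^ (-α)) * x) (Ioi 0) := by
  have h : ContinuousOn (fun x : ℝ => x ^ (-α)) (Ioi 0) := fun x hx =>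
    (Real.continuousAt_rpow_const x _ (Or.inl (ne_of_gt hx))).continuousWithinAt
  refine ((continuousOn_const.mul h).div (continuousOn_const.add (continuousOn_const.mul h))
    fun x hx => ?_).mul continuousOn_id
  have hx0 : (0 : ℝ) < x := hx
  have h1 : 0 < 1 + s * P * x ^ (-α) := by positivity
  exact ne_of_gt h1

theorem exponentIntegrand_nonneg {P α s : ℝ} (hP : 0 < P) (hs : 0 ≤ s) {x : ℝ} (hx : 0 < x) :
    0 ≤ s * P * x ^ (-α) / (1 + s * P * x ^ (-α)) * x := by positivity

/-- The majorant is integrable at infinity exactly because α > 2, and being linear in `s` it also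
dominates locally uniformly in `s`. -/
theorem exponentIntegrand_le {P α s : ℝ} (hP : 0 < P) (hs : 0 ≤ s) {x : ℝ} (hx : 0 < x) :
    s * P * x ^ (-α) / (1 + s * P * x ^ (-α)) * x ≤ s * P * x ^ (1 - α) := by
  have h1 : x ^ (1 - α) = x ^ (-α) * x := by
    rw [show 1 - α = -α + 1 by ring, Real.rpow_add hx, Real.rpow_one]
  have hc : 0 ≤ s * P * x ^ (-α) := by positivity
  rw [h1, ← mul_assoc]
  gcongr
  exact div_le_self hc (by linarith)

theorem integrableOn_exponentIntegrand {P α s r : ℝ} (hP : 0 < P) (hα : 2 < α) (hs : 0 ≤ s)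
    (hr : 0 < r) :
    IntegrableOn (fun x : ℝ => s * P * x ^ (-α) / (1 + s * P * x ^ (-α)) * x) (Ioi r) := by
  refine Integrable.mono' ((integrableOn_Ioi_rpow_of_lt (a := 1 - α) (by linarith) hr).const_mul
    (s * P)) (((continuousOn_exponentIntegrand hP hs).mono
      (Ioi_subset_Ioi hr.le)).aestronglyMeasurable measurableSet_Ioi) ?_
  filter_upwards [ae_restrict_mem measurableSet_Ioi] with x hx
  have hx0 : 0 < x := hr.trans hx
  rw [Real.norm_eq_abs, abs_of_nonneg (exponentIntegrand_nonneg hP hs hx0)]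
  exact exponentIntegrand_le hP hs hx0

theorem interferenceExponent_zero (P α r : ℝ) : interferenceExponent P α 0 r = 0 := by
  simp [interferenceExponent]

theorem continuousOn_interferenceExponent {P α s : ℝ} (hP : 0 < P) (hα : 2 < α) (hs : 0 ≤ s) :
    ContinuousOn (interferenceExponent P α s) (Ioi 0) := by
  intro r hr
  have hr0 : 0 < r := hr
  have hI : ∀ a, 0 < a → IntegrableOn
      (fun x : ℝ => s * P * x ^ (-α) / (1 + s * P * x ^ (-α)) * x) (Ioi a) := fun a ha =>
    integrableOn_exponentIntegrand hP hα hs ha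
  have hc : ContinuousOn (fun b => ∫ x in (r / 2)..b,
      s * P * x ^ (-α) / (1 + s * P * x ^ (-α)) * x) (uIcc (r / 2) (r + 1)) := by
    refine intervalIntegral.continuousOn_primitive_interval ?_
    rw [uIcc_of_le (by linarith)]
    -- The smaller radius r/4 is needed because the interval is closed at r/2 while `Ioi` is open.
    exact (hI (r / 4) (by linarith)).mono_set fun x hx => by
      rw [mem_Ioi]; linarith [hx.1]
  rw [uIcc_of_le (by linarith)] at hc
  have hca := hc.continuousAt (x := r) (Icc_mem_nhds (by linarith) (by linarith))
  refine ContinuousAt.continuousWithinAt ?_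
  refine (continuousAt_const.sub hca).congr (f := fun b =>
    interferenceExponent P α s (r / 2) - ∫ x in (r / 2)..b,
      s * P * x ^ (-α) / (1 + s * P * x ^ (-α)) * x) ?_
  filter_upwards [lt_mem_nhds hr0] with b hb
  rw [interferenceExponent, ← intervalIntegral.integral_interval_add_Ioi (hI (r / 2) (by linarith))
    (hI b hb), interferenceExponent]
  ring

theorem continuousOn_interferenceExponent_param {P α r : ℝ} (hP : 0 < P) (hα : 2 < α)
    (hr : 0 < r) : ContinuousOn (fun s => interferenceExponent P α s r) (Ici 0) := by
  intro s hs
  refine continuousWithinAt_of_dominated (bound := fun x => (s + 1) * P * x ^ (1 - α)) ?_ ?_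
    ((integrableOn_Ioi_rpow_of_lt (a := 1 - α) (by linarith) hr).const_mul _) ?_
  · filter_upwards [self_mem_nhdsWithin] with t ht
    exact (integrableOn_exponentIntegrand hP hα ht hr).aestronglyMeasurable
  · filter_upwards [self_mem_nhdsWithin,
      mem_nhdsWithin_of_mem_nhds (gt_mem_nhds (show s < s + 1 by linarith))] with t ht ht'
    filter_upwards [ae_restrict_mem measurableSet_Ioi] with x hx
    have hx0 : 0 < x := hr.trans hx
    rw [Real.norm_eq_abs, abs_of_nonneg (exponentIntegrand_nonneg hP ht hx0)]
    refine (exponentIntegrand_le hP ht hx0).trans ?_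
    have : t ≤ s + 1 := le_of_lt ht'
    gcongr
  · filter_upwards [ae_restrict_mem measurableSet_Ioi] with x hx
    have hx0 : 0 < x := hr.trans hx
    have hs0 : (0 : ℝ) ≤ s := hs
    have : 1 + s * P * x ^ (-α) ≠ 0 := by positivity
    exact ContinuousAt.continuousWithinAt (by fun_prop (disch := assumption))

/-- With q = √β and k = q r², the integrand is k² x / (x⁴ + k²), with primitive (k/2) arctan(x²/k).
The boundary terms leave π/2 - arctan(1/q) = arctan q. The case β = 0 is separate because of the
division by q. -/
theorem interferenceExponent_four {P r β : ℝ} (hP : 0 < P) (hr : 0 < r) (hβ : 0 ≤ β) :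
    interferenceExponent P 4 (β * r ^ 4 / P) r
      = r ^ 2 / 2 * (Real.sqrt β * Real.arctan (Real.sqrt β)) := by
  rcases hβ.eq_or_lt with rfl | hβ
  · simp [interferenceExponent]
  set q := Real.sqrt β with hq
  have hq0 : 0 < q := Real.sqrt_pos.2 hβ
  have hqs : q ^ 2 = β := Real.sq_sqrt hβ.le
  have hk : 0 < q * r ^ 2 := by positivity
  have hder : ∀ x ∈ Ici r, HasDerivAt
      (fun x : ℝ => q * r ^ 2 / 2 * Real.arctan (x ^ 2 / (q * r ^ 2)))
      (β * r ^ 4 / P * P * x ^ (-(4 : ℝ)) / (1 + β * r ^ 4 / P * P * x ^ (-(4 : ℝ))) * x) x := by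
    intro x hx
    have hx0 : 0 < x := hr.trans_le hx
    have h := (((hasDerivAt_pow 2 x).div_const (q * r ^ 2)).arctan).const_mul (q * r ^ 2 / 2)
    refine h.congr_deriv ?_
    have h4 : x ^ (-(4 : ℝ)) = (x ^ 4)⁻¹ := by
      rw [Real.rpow_neg hx0.le]; norm_cast
    rw [h4, ← hqs]
    field_simp
    push_cast
    ring
  have hlim : Tendsto (fun x : ℝ => q * r ^ 2 / 2 * Real.arctan (x ^ 2 / (q * r ^ 2))) atTop
      (𝓝 (q * r ^ 2 / 2 * (Real.pi / 2))) := by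
    refine Tendsto.const_mul _ ((tendsto_nhds_of_tendsto_nhdsWithin
      Real.tendsto_arctan_atTop).comp ?_)
    exact (tendsto_pow_atTop two_ne_zero).atTop_div_const hk
  rw [interferenceExponent, integral_Ioi_of_hasDerivAt_of_nonneg' hder (fun x hx => by
    have hx0 : 0 < x := hr.trans hx
    positivity) hlim]
  have h1 : r ^ 2 / (q * r ^ 2) = q⁻¹ := by field_simp
  rw [h1, Real.arctan_inv_of_pos hq0]
  ring

/-! ### Integrals over the plane -/

theorem Plane.measureReal_closedBall {a : ℝ} (ha : 0 ≤ a) :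
    volume.real (Metric.closedBall (0 : Plane) a) = Real.pi * a ^ 2 := by
  rw [measureReal_def, EuclideanSpace.volume_closedBall_fin_two, ENNReal.toReal_mul,
    ENNReal.toReal_pow, ENNReal.toReal_ofReal ha, ENNReal.toReal_ofReal Real.pi_pos.le]
  ring

theorem Plane.integrable_indicator_norm {f : ℝ → ℝ} {b : ℝ}
    (hf : IntegrableOn (fun y => f y * y) (Ioi b)) :
    Integrable (fun x : Plane => (Ioi b).indicator f ‖x‖) := by
  rw [integrable_fun_norm_addHaar volume (f := (Ioi b).indicator f)]
  have h : IntegrableOn ((Ioi b).indicator fun y => f y * y) (Ioi 0) :=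
    ((integrable_indicator_iff measurableSet_Ioi).2 hf).integrableOn
  refine h.congr_fun (fun y _ => ?_) measurableSet_Ioi
  by_cases hy : y ∈ Ioi b <;> simp [hy, mul_comm]

theorem Plane.integral_indicator_norm (f : ℝ → ℝ) {b : ℝ} (hb : 0 < b) :
    ∫ x : Plane, (Ioi b).indicator f ‖x‖ = 2 * Real.pi * ∫ y in Ioi b, f y * y := by
  rw [integral_fun_norm_addHaar volume ((Ioi b).indicator f)]
  have h1 : volume.real (Metric.ball (0 : Plane) 1) = Real.pi := by
    rw [measureReal_def, EuclideanSpace.volume_ball_fin_two, ENNReal.toReal_mul,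
      ENNReal.toReal_pow, ENNReal.toReal_ofReal zero_le_one, ENNReal.toReal_ofReal Real.pi_pos.le]
    ring
  have h2 : ∫ y in Ioi (0 : ℝ), y ^ (Module.finrank ℝ Plane - 1) • (Ioi b).indicator f y
      = ∫ y in Ioi b, f y * y := by
    rw [← integral_indicator measurableSet_Ioi, ← integral_indicator measurableSet_Ioi]
    congr 1 with y
    by_cases hy : b < y
    · simp [hy, hb.trans hy, mul_comm]
    · simp [indicator, hy]
  rw [h1, h2]
  simp
  ring

/-! ### Independent marks -/

/-- Integrating out the independent marks of a sequence of random points. -/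
theorem integral_prod_marked {Ω S : Type*} [MeasurableSpace Ω] [MeasurableSpace S] {μ : Measure Ω}
    [IsProbabilityMeasure μ] {X : ℕ → Ω → Plane} {m : ℕ → Ω → S}
    (hX : ∀ i, Measurable (X i)) (hm : ∀ i, Measurable (m i)) (hind : iIndepFun m μ)
    (hXm : IndepFun (fun ω i => X i ω) (fun ω i => m i ω) μ)
    {f : Plane × S → ℝ} (hf : Measurable f) (hf1 : ∀ z, |f z| ≤ 1) {g : Plane → ℝ}
    (hg : ∀ i x, ∫ ω, f (x, m i ω) ∂μ = g x) (n : ℕ) :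
    ∫ ω, ∏ i ∈ Finset.range n, f (X i ω, m i ω) ∂μ
      = ∫ ω, ∏ i ∈ Finset.range n, g (X i ω) ∂μ := by
  have hXs : Measurable fun ω i => X i ω := measurable_pi_lambda _ hX
  have hms : Measurable fun ω i => m i ω := measurable_pi_lambda _ hm
  have hF : Measurable fun z : (ℕ → Plane) × (ℕ → S) =>
      ∏ i ∈ Finset.range n, f (z.1 i, z.2 i) := by
    refine Finset.measurable_prod _ fun i _ => hf.comp ?_
    fun_prop
  have hFi : Integrable (fun z : (ℕ → Plane) × (ℕ → S) => ∏ i ∈ Finset.range n, f (z.1 i, z.2 i))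
      ((μ.map fun ω i => X i ω).prod (μ.map fun ω i => m i ω)) := by
    have := Measure.isProbabilityMeasure_map (μ := μ) hXs.aemeasurable
    have := Measure.isProbabilityMeasure_map (μ := μ) hms.aemeasurable
    refine Integrable.of_bound (C := 1) hF.aestronglyMeasurable (ae_of_all _ fun z => ?_)
    rw [Real.norm_eq_abs, Finset.abs_prod]
    exact Finset.prod_le_one (fun _ _ => abs_nonneg _) fun i _ => hf1 _
  have hinner : ∀ x : ℕ → Plane,
      ∫ y, ∏ i ∈ Finset.range n, f (x i, y i) ∂(μ.map fun ω i => m i ω)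
        = ∏ i ∈ Finset.range n, g (x i) := by
    intro x
    rw [integral_map (f := fun y : ℕ → S => ∏ i ∈ Finset.range n, f (x i, y i)) hms.aemeasurable
      (hF.comp measurable_prodMk_left).aestronglyMeasurable]
    simp_rw [Finset.prod_range]
    have hind' : iIndepFun (fun i : Fin n => m i) μ := hind.precomp Fin.val_injective
    rw [hind'.integral_fun_prod_comp (f := fun (i : Fin n) y => f (x i, y))
      (fun i => (hm i).aemeasurable)
      (fun i => (hf.comp measurable_prodMk_left).aestronglyMeasurable)]
    simp_rw [hg]
  -- Measurability of `g` comes from its formula as a parametric integral, read off at the index 0.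
  have hgm : Measurable g := by
    have h : StronglyMeasurable fun x => ∫ ω, f (x, m 0 ω) ∂μ :=
      StronglyMeasurable.integral_prod_right (f := fun x ω => f (x, m 0 ω))
        (hf.comp (measurable_fst.prodMk ((hm 0).comp measurable_snd))).stronglyMeasurable
    simp_rw [hg] at h
    exact h.measurable
  calc ∫ ω, ∏ i ∈ Finset.range n, f (X i ω, m i ω) ∂μ
      = ∫ z, ∏ i ∈ Finset.range n, f (z.1 i, z.2 i)
          ∂(μ.map fun ω => ((fun i => X i ω), (fun i => m i ω))) :=
        (integral_map (f := fun z : (ℕ → Plane) × (ℕ → S) =>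
          ∏ i ∈ Finset.range n, f (z.1 i, z.2 i)) (hXs.prodMk hms).aemeasurable
          hF.aestronglyMeasurable).symm
    _ = ∫ x, ∏ i ∈ Finset.range n, g (x i) ∂(μ.map fun ω i => X i ω) := by
        rw [hXm.map_prod_eq_prod_map_map hXs.aemeasurable hms.aemeasurable,
          integral_prod _ hFi]
        simp_rw [hinner]
    _ = ∫ ω, ∏ i ∈ Finset.range n, g (X i ω) ∂μ := by
        refine integral_map (f := fun x : ℕ → Plane => ∏ i ∈ Finset.range n, g (x i))
          hXs.aemeasurable (Measurable.aestronglyMeasurable ?_)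
        exact Finset.measurable_prod _ fun i _ => hgm.comp (measurable_pi_apply i)

/-! ### Interference from outside a disc -/

open Classical in
/-- The power received at the origin from user `i` if it has role `t` and lies outside the disc of
radius `b`. -/
def outerTerm {Ω : Type*} (X : ℕ → Ω → Plane) (role : ℕ → Ω → Role) (h : ℕ → Ω → ℝ)
    (P α : ℝ) (t : Role) (b : ℝ) (ω : Ω) (i : ℕ) : ℝ :=
  if role i ω = t ∧ b < ‖X i ω‖ then P * h i ω * ‖X i ω‖ ^ (-α) else 0

theorem outerTerm_nonneg {Ω : Type*} {X : ℕ → Ω → Plane} {role : ℕ → Ω → Role}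
    {h : ℕ → Ω → ℝ} {P α : ℝ} (hP : 0 < P) {t : Role} {b : ℝ} {ω : Ω}
    {i : ℕ} (hh : 0 ≤ h i ω) :
    0 ≤ outerTerm X role h P α t b ω i := by
  rw [outerTerm]
  split_ifs
  · positivity
  · exact le_rfl

/-- No user of role `t` lies in the disc of radius `a`. -/
def IsVoid {Ω : Type*} (X : ℕ → Ω → Plane) (role : ℕ → Ω → Role) (t : Role) (a : ℝ) (ω : Ω) :
    Prop :=
  ∀ i, role i ω = t → a < ‖X i ω‖

open Classical in
/-- The probability that a user at `x` of role `t` and gain `y` is retained, when the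
users in the disc of radius `a` are deleted and those outside the disc of radius `b` are kept with
probability `exp (-s P y ‖x‖ ^ (-α))`. -/
def retention (P α s : ℝ) (t : Role) (a b : ℝ) (z : Plane × Role × ℝ) : ℝ :=
  if z.2.1 = t then
    if ‖z.1‖ ≤ a then 0
    -- Gains are nonnegative only almost surely; the truncation keeps the value in [0, 1]
    -- everywhere.
    else if b < ‖z.1‖ then Real.exp (-(s * P * ‖z.1‖ ^ (-α)) * max z.2.2 0) else 1
  else 1

theorem measurable_retention (P α s : ℝ) (t : Role) (a b : ℝ) :
    Measurable (retention P α s t a b) := by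
  have ht : MeasurableSet {z : Plane × Role × ℝ | z.2.1 = t} :=
    (measurable_fst.comp measurable_snd) (MeasurableSpace.measurableSet_top (s := {t}))
  have hn : Measurable fun z : Plane × Role × ℝ => ‖z.1‖ := measurable_fst.norm
  have hg : Measurable fun z : Plane × Role × ℝ => z.2.2 := measurable_snd.comp measurable_snd
  refine Measurable.ite ht (Measurable.ite (measurableSet_le hn measurable_const) measurable_const
    (Measurable.ite (measurableSet_lt measurable_const hn) ?_ measurable_const)) measurable_const
  exact (((hn.pow_const _).const_mul _).neg.mul (hg.max measurable_const)).exp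

theorem retention_mem_Icc {P α s : ℝ} (hP : 0 < P) (hs : 0 ≤ s) (t : Role) (a b : ℝ)
    (z : Plane × Role × ℝ) : retention P α s t a b z ∈ Icc (0 : ℝ) 1 := by
  rw [retention]
  have : 0 ≤ s * P * ‖z.1‖ ^ (-α) * max z.2.2 0 :=
    mul_nonneg (by positivity) (le_max_right _ _)
  split_ifs
  · simp
  · exact ⟨(Real.exp_pos _).le, Real.exp_le_one_iff.2 (by linarith)⟩
  · simp
  · simp

/-! ### Averages over the marked network: void events and outer interference -/

section Network

variable {Ω : Type*} [MeasurableSpace Ω] {μ : Measure Ω}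
  {X : ℕ → Ω → Plane} {role : ℕ → Ω → Role} {h : ℕ → Ω → ℝ} {lam pHD pFD P α : ℝ}

instance sigmaFinite_ofReal_smul_volume (c : ℝ) :
    SigmaFinite (ENNReal.ofReal c • (volume : Measure Plane)) :=
  inferInstanceAs (SigmaFinite (c.toNNReal • (volume : Measure Plane)))

namespace IsD2DNetwork

theorem measurableSet_role (hnet : IsD2DNetwork X role h lam pHD pFD μ) (i : ℕ) (t : Role) :
    MeasurableSet {ω | role i ω = t} :=
  hnet.measurable_role i (MeasurableSpace.measurableSet_top (s := {t}))

theorem measurable_norm_position (hnet : IsD2DNetwork X role h lam pHD pFD μ) (i : ℕ) :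
    Measurable fun ω => ‖X i ω‖ :=
  (hnet.poisson.measurable i).norm

theorem ae_gain_nonneg (hnet : IsD2DNetwork X role h lam pHD pFD μ) :
    ∀ᵐ ω ∂μ, ∀ i, 0 ≤ h i ω := by
  refine ae_all_iff.2 fun i => ?_
  exact ((hnet.gain_law i).ae_iff (p := fun x => 0 ≤ x)
    (measurableSet_setOfPred.1 measurableSet_Ici)).2 ae_nonneg_expMeasure

theorem ae_finite_ball (hnet : IsD2DNetwork X role h lam pHD pFD μ) (b : ℝ) :
    ∀ᵐ ω ∂μ, {i | ‖X i ω‖ ≤ b}.Finite := by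
  have h := hnet.poisson.ae_finite (B := Metric.closedBall 0 b) measurableSet_closedBall
    (by
      rw [Measure.smul_apply, smul_eq_mul]
      exact ENNReal.mul_ne_top ENNReal.ofReal_ne_top measure_closedBall_lt_top.ne)
  simpa using h

/-- One minus the retention is the indicator of the role times a function of the gain, and the two
are independent. Beyond `b` the gain contributes 1 - 1/(1 + c) with c = sP‖x‖^(-α). The condition a
≤ b keeps the two regions disjoint. -/
theorem integral_retention [IsProbabilityMeasure μ]
    (hnet : IsD2DNetwork X role h lam pHD pFD μ) (hP : 0 < P) {s : ℝ}
    (hs : 0 ≤ s) (t : Role) (hp : 0 ≤ roleProb pHD pFD t) {a b : ℝ} (hab : a ≤ b) (i : ℕ)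
    (x : Plane) :
    ∫ ω, retention P α s t a b (x, role i ω, h i ω) ∂μ
      = 1 - roleProb pHD pFD t * ((Iic a).indicator 1 ‖x‖
        + (Ioi b).indicator (fun y => s * P * y ^ (-α) / (1 + s * P * y ^ (-α))) ‖x‖) := by
  classical
  set w : ℝ → ℝ := fun y => if ‖x‖ ≤ a then 1 else if b < ‖x‖ then
    1 - Real.exp (-(s * P * ‖x‖ ^ (-α)) * max y 0) else 0 with hw
  have hwm : Measurable w := by
    refine Measurable.ite (MeasurableSet.const _) measurable_const
      (Measurable.ite (MeasurableSet.const _) ?_ measurable_const)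
    fun_prop
  have hret : ∀ ω, retention P α s t a b (x, role i ω, h i ω)
      = 1 - (({t} : Set Role).indicator 1 (role i ω)) * w (h i ω) := by
    intro ω
    simp only [retention, hw, indicator, mem_singleton_iff, Pi.one_apply]
    split_ifs <;> ring
  have hind : Measurable (({t} : Set Role).indicator (1 : Role → ℝ)) :=
    measurable_one.indicator MeasurableSpace.measurableSet_top
  have hc : 0 ≤ s * P * ‖x‖ ^ (-α) := by positivity
  have hw1 : ∀ y, ‖w y‖ ≤ 1 := by
    intro y
    have h1 : Real.exp (-(s * P * ‖x‖ ^ (-α)) * max y 0) ≤ 1 :=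
      Real.exp_le_one_iff.2 (by nlinarith [le_max_right y 0, mul_nonneg hc (le_max_right y 0)])
    have h2 := Real.exp_pos (-(s * P * ‖x‖ ^ (-α)) * max y 0)
    simp only [hw]
    split_ifs
    · simp
    · rw [Real.norm_eq_abs, abs_le]; constructor <;> linarith
    · simp
  have hwi : ∫ ω, w (h i ω) ∂μ = (Iic a).indicator 1 ‖x‖
        + (Ioi b).indicator (fun y => s * P * y ^ (-α) / (1 + s * P * y ^ (-α))) ‖x‖ := by
    by_cases h1 : ‖x‖ ≤ a
    · have h2 : ¬ b < ‖x‖ := not_lt.2 (h1.trans hab)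
      simp [hw, h1, h2]
    · by_cases h2 : b < ‖x‖
      · have he : ∫ ω, Real.exp (-(s * P * ‖x‖ ^ (-α)) * max (h i ω) 0) ∂μ
            = 1 / (1 + s * P * ‖x‖ ^ (-α)) := by
          rw [← integral_exp_neg_mul_expMeasure (c := s * P * ‖x‖ ^ (-α)) (by linarith),
            ← (hnet.gain_law i).integral_comp (by fun_prop)]
          refine integral_congr_ae ?_
          filter_upwards [hnet.ae_gain_nonneg] with ω hω
          rw [max_eq_left (hω i)]; rfl
        have hi : Integrable (fun ω => Real.exp (-(s * P * ‖x‖ ^ (-α)) * max (h i ω) 0)) μ := by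
          refine Integrable.of_bound (C := 1) ?_ (ae_of_all _ fun ω => ?_)
          · have := hnet.measurable_gain i
            exact Measurable.aestronglyMeasurable (by fun_prop)
          · rw [Real.norm_eq_abs, Real.abs_exp]
            exact Real.exp_le_one_iff.2 (by
              nlinarith [mul_nonneg hc (le_max_right (h i ω) 0)])
        simp only [hw, h1, h2, if_false, if_true]
        rw [integral_sub (integrable_const _) hi, he]
        have : 1 + s * P * ‖x‖ ^ (-α) ≠ 0 := by positivity
        simp [h1, h2]
        field_simp
        ring
      · simp [hw, h1, h2]
  have hri : ∫ ω, ({t} : Set Role).indicator (1 : Role → ℝ) (role i ω) ∂μ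
      = roleProb pHD pFD t := by
    have : (fun ω => ({t} : Set Role).indicator (1 : Role → ℝ) (role i ω))
        = {ω | role i ω = t}.indicator 1 := by
      ext ω; simp [indicator]
    rw [this, integral_indicator_one (hnet.measurableSet_role i t), measureReal_def,
      hnet.role_law, ENNReal.toReal_ofReal hp]
  simp_rw [hret]
  rw [integral_sub (integrable_const _), (hnet.indep_role_gain i).integral_fun_comp_mul_comp
    (hnet.measurable_role i).aemeasurable (hnet.measurable_gain i).aemeasurable
    hind.aestronglyMeasurable hwm.aestronglyMeasurable, hri, hwi]
  · simp
  · refine Integrable.of_bound (C := 1) ((hind.comp (hnet.measurable_role i)).mul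
      (hwm.comp (hnet.measurable_gain i))).aestronglyMeasurable (ae_of_all _ fun ω => ?_)
    rw [norm_mul]
    refine mul_le_one₀ ?_ (norm_nonneg _) (hw1 _)
    by_cases hr : role i ω = t <;> simp [hr]

theorem integrable_exclusion (hP : 0 < P) (hα : 2 < α) {s : ℝ} (hs : 0 ≤ s) {a b : ℝ}
    (hb : 0 < b) (c : ℝ) :
    Integrable (fun x : Plane => c * ((Iic a).indicator 1 ‖x‖
      + (Ioi b).indicator (fun y => s * P * y ^ (-α) / (1 + s * P * y ^ (-α))) ‖x‖)) := by
  refine Integrable.const_mul (Integrable.add ?_ (Plane.integrable_indicator_norm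
    (integrableOn_exponentIntegrand hP hα hs hb))) _
  have h1 : (fun x : Plane => (Iic a).indicator (1 : ℝ → ℝ) ‖x‖)
      = (Metric.closedBall (0 : Plane) a).indicator 1 := by
    ext x; simp [indicator]
  rw [h1, integrable_indicator_iff measurableSet_closedBall]
  exact integrableOn_const measure_closedBall_lt_top.ne

theorem integral_exclusion (hP : 0 < P) (hα : 2 < α) {s : ℝ} (hs : 0 ≤ s) {a b : ℝ}
    (ha : 0 ≤ a) (hb : 0 < b) (c : ℝ) :
    ∫ x : Plane, c * ((Iic a).indicator 1 ‖x‖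
      + (Ioi b).indicator (fun y => s * P * y ^ (-α) / (1 + s * P * y ^ (-α))) ‖x‖)
      = c * (Real.pi * a ^ 2 + 2 * Real.pi * interferenceExponent P α s b) := by
  have h1 : (fun x : Plane => (Iic a).indicator (1 : ℝ → ℝ) ‖x‖)
      = (Metric.closedBall (0 : Plane) a).indicator 1 := by
    ext x; simp [indicator]
  have hi : Integrable fun x : Plane => (Iic a).indicator (1 : ℝ → ℝ) ‖x‖ := by
    rw [h1, integrable_indicator_iff measurableSet_closedBall]
    exact integrableOn_const measure_closedBall_lt_top.ne
  rw [integral_const_mul, integral_add hi (Plane.integrable_indicator_norm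
    (integrableOn_exponentIntegrand hP hα hs hb)), h1,
    integral_indicator_one measurableSet_closedBall, Plane.measureReal_closedBall ha,
    Plane.integral_indicator_norm _ hb, interferenceExponent]

theorem measurable_outerTerm (hnet : IsD2DNetwork X role h lam pHD pFD μ) (t : Role) (b : ℝ)
    (i : ℕ) : Measurable fun ω => outerTerm X role h P α t b ω i := by
  have h1 := hnet.measurable_norm_position i
  have h2 := hnet.measurable_gain i
  refine Measurable.ite ((hnet.measurableSet_role i t).inter
    (measurableSet_lt measurable_const h1)) ?_ measurable_const
  exact (h2.const_mul P).mul (h1.pow_const _)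

/-- The sum has finite mean: after dropping the role, position and gain separate by independence,
the gain has finite mean, and Campbell's formula leaves the integral of y^(1 - α) beyond b > 0. -/
theorem ae_summable_outerTerm (hnet : IsD2DNetwork X role h lam pHD pFD μ) (hP : 0 < P)
    (hα : 2 < α) (t : Role) {b : ℝ} (hb : 0 < b) :
    ∀ᵐ ω ∂μ, Summable (outerTerm X role h P α t b ω) := by
  set φ : Plane → ℝ≥0∞ := fun x =>
    ENNReal.ofReal ((Ioi b).indicator (fun y => P * y ^ (-α)) ‖x‖) with hφ
  have hφm : Measurable φ := by
    refine ENNReal.measurable_ofReal.comp ((Measurable.indicator ?_ measurableSet_Ioi).comp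
      measurable_norm)
    fun_prop
  have hφi : ∫⁻ x, φ x ∂(ENNReal.ofReal lam • volume) ≠ ∞ := by
    rw [lintegral_smul_measure, smul_eq_mul]
    refine ENNReal.mul_ne_top ENNReal.ofReal_ne_top ?_
    have hint : Integrable (fun x : Plane => (Ioi b).indicator (fun y => P * y ^ (-α)) ‖x‖) := by
      refine Plane.integrable_indicator_norm ?_
      have hr : IntegrableOn (fun y : ℝ => P * y ^ (1 - α)) (Ioi b) :=
        (integrableOn_Ioi_rpow_of_lt (by linarith) hb).const_mul P
      refine hr.congr_fun (fun y hy => ?_) measurableSet_Ioi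
      have hy0 : 0 < y := hb.trans hy
      change P * y ^ (1 - α) = P * y ^ (-α) * y
      rw [show 1 - α = -α + 1 by ring, Real.rpow_add hy0, Real.rpow_one, mul_assoc]
    exact hint.lintegral_lt_top.ne
  have hfin : ∫⁻ ω, ∑' i, ENNReal.ofReal (outerTerm X role h P α t b ω i) ∂μ ≠ ∞ := by
    rw [lintegral_tsum fun i => (hnet.measurable_outerTerm t b i).ennreal_ofReal.aemeasurable]
    have hle : ∀ i, ∫⁻ ω, ENNReal.ofReal (outerTerm X role h P α t b ω i) ∂μ
        ≤ (∫⁻ x, ENNReal.ofReal x ∂(expMeasure 1)) * ∫⁻ ω, φ (X i ω) ∂μ := by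
      intro i
      have hind : IndepFun (fun ω => φ (X i ω)) (fun ω => ENNReal.ofReal (h i ω)) μ :=
        hnet.indep_position.comp (φ := fun x : ℕ → Plane => φ (x i))
          (ψ := fun m : ℕ → Role × ℝ => ENNReal.ofReal (m i).2)
          (hφm.comp (measurable_pi_apply i))
          (measurable_snd.comp (measurable_pi_apply i)).ennreal_ofReal
      rw [← (hnet.gain_law i).lintegral_comp (by fun_prop), mul_comm,
        ← lintegral_mul_eq_lintegral_mul_lintegral_of_indepFun (f := fun ω => φ (X i ω))
          (hφm.comp (hnet.poisson.measurable i)) (hnet.measurable_gain i).ennreal_ofReal hind]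
      refine lintegral_mono_ae ?_
      filter_upwards [hnet.ae_gain_nonneg] with ω hω
      rw [Pi.mul_apply, hφ, ← ENNReal.ofReal_mul (by
        refine indicator_nonneg (fun y (hy : b < y) => ?_) _
        have : 0 < y := hb.trans hy
        positivity)]
      refine ENNReal.ofReal_le_ofReal ?_
      rw [outerTerm]
      by_cases hX : b < ‖X i ω‖
      · have hn : 0 ≤ P * ‖X i ω‖ ^ (-α) * h i ω := by
          have := hω i
          positivity
        rw [indicator_of_mem (show ‖X i ω‖ ∈ Ioi b from hX)]
        split_ifs
        · exact le_of_eq (by ring)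
        · exact hn
      · simp [hX]
    refine ne_top_of_le_ne_top ?_ (ENNReal.tsum_le_tsum hle)
    rw [ENNReal.tsum_mul_left, hnet.poisson.tsum_lintegral hφm]
    exact ENNReal.mul_ne_top lintegral_ofReal_expMeasure_ne_top hφi
  have hlt := ae_lt_top' (AEMeasurable.tsum fun i =>
    (hnet.measurable_outerTerm t b i).ennreal_ofReal.aemeasurable) hfin
  filter_upwards [hlt, hnet.ae_gain_nonneg] with ω hω hh
  have := ENNReal.summable_toReal hω.ne
  refine this.congr fun i => ?_
  rw [ENNReal.toReal_ofReal (outerTerm_nonneg hP (hh i))]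

open Classical in
-- The product of all retentions is the void indicator times exp(-s J). Its mean is the generating
-- functional at one minus the mean retention, whose integral splits into the disc area and the
-- radial exponent. The thinning by role enters only through the factor `p`.
theorem integral_void_mul_exp [IsProbabilityMeasure μ]
    (hnet : IsD2DNetwork X role h lam pHD pFD μ) (hlam : 0 < lam)
    (hP : 0 < P) (hα : 2 < α) {s : ℝ} (hs : 0 ≤ s) (t : Role)
    (hp : roleProb pHD pFD t ∈ Icc (0 : ℝ) 1) {a b : ℝ} (ha : 0 ≤ a) (hab : a ≤ b) (hb : 0 < b) :
    ∫ ω, (if IsVoid X role t a ω then Real.exp (-s * ∑' i, outerTerm X role h P α t b ω i)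
      else 0) ∂μ
      = Real.exp (-(lam * roleProb pHD pFD t * Real.pi * a ^ 2))
        * Real.exp (-2 * Real.pi * (lam * roleProb pHD pFD t) * interferenceExponent P α s b) := by
  set p := roleProb pHD pFD t with hpdef
  set u : Plane → ℝ := fun x => p * ((Iic a).indicator 1 ‖x‖
    + (Ioi b).indicator (fun y => s * P * y ^ (-α) / (1 + s * P * y ^ (-α))) ‖x‖) with hu
  have hum : Measurable u := by
    refine ((measurable_one.indicator measurableSet_Iic).comp measurable_norm).add
      ((Measurable.indicator ?_ measurableSet_Ioi).comp measurable_norm) |>.const_mul p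
    fun_prop
  have hu01 : ∀ x, u x ∈ Icc (0 : ℝ) 1 := by
    intro x
    have hv : (Iic a).indicator 1 ‖x‖
        + (Ioi b).indicator (fun y => s * P * y ^ (-α) / (1 + s * P * y ^ (-α))) ‖x‖
          ∈ Icc (0 : ℝ) 1 := by
      by_cases h1 : ‖x‖ ≤ a
      · have h2 : ¬ b < ‖x‖ := not_lt.2 (h1.trans hab)
        simp [h1, h2]
      · by_cases h2 : b < ‖x‖
        · have hc : 0 ≤ s * P * ‖x‖ ^ (-α) := by positivity
          simp only [mem_Iic, h1, not_false_eq_true, indicator_of_notMem, mem_Ioi, h2,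
            indicator_of_mem, zero_add]
          exact ⟨by positivity, div_le_one_of_le₀ (by linarith) (by linarith)⟩
        · simp [h1, h2]
    exact ⟨mul_nonneg hp.1 hv.1, mul_le_one₀ hp.2 hv.1 hv.2⟩
  have hui : Integrable u (ENNReal.ofReal lam • volume) :=
    (integrable_exclusion hP hα hs hb p).smul_measure ENNReal.ofReal_ne_top
  have hlim := hnet.poisson.tendsto_integral_prod hum hu01 hui
  have hexp : Real.exp (-∫ x, u x ∂(ENNReal.ofReal lam • (volume : Measure Plane)))
      = Real.exp (-(lam * p * Real.pi * a ^ 2))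
        * Real.exp (-2 * Real.pi * (lam * p) * interferenceExponent P α s b) := by
    rw [integral_smul_measure, hu, integral_exclusion hP hα hs ha hb, ENNReal.toReal_ofReal hlam.le,
      ← Real.exp_add, smul_eq_mul]
    congr 1; ring
  rw [hexp] at hlim
  have hret := retention_mem_Icc (α := α) hP hs t a b
  have hmarked : ∀ n, ∫ ω, ∏ i ∈ Finset.range n, retention P α s t a b (X i ω, role i ω, h i ω) ∂μ
      = ∫ ω, ∏ i ∈ Finset.range n, (1 - u (X i ω)) ∂μ :=
    integral_prod_marked (m := fun i ω => (role i ω, h i ω)) (g := fun x => 1 - u x)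
      hnet.poisson.measurable
      (fun i => (hnet.measurable_role i).prodMk (hnet.measurable_gain i)) hnet.indep_marks
      hnet.indep_position (measurable_retention P α s t a b)
      (fun z => by rw [abs_of_nonneg (hret z).1]; exact (hret z).2)
      (fun i x => hnet.integral_retention hP hs t hp.1 hab i x)
  simp_rw [← hmarked] at hlim
  -- The partial products also converge pathwise to the integrand on the left, and are bounded by 1.
  refine tendsto_nhds_unique ?_ hlim
  refine tendsto_integral_of_dominated_convergence (fun _ => 1) (fun n => ?_)
    (integrable_const _) (fun n => ?_) ?_
  · refine (Finset.measurable_prod _ fun i _ => (measurable_retention P α s t a b).comp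
      ((hnet.poisson.measurable i).prodMk
        ((hnet.measurable_role i).prodMk (hnet.measurable_gain i)))).aestronglyMeasurable
  · refine ae_of_all _ fun ω => ?_
    rw [Real.norm_eq_abs, abs_of_nonneg (Finset.prod_nonneg fun i _ => (hret _).1)]
    exact Finset.prod_le_one (fun i _ => (hret _).1) fun i _ => (hret _).2
  · filter_upwards [hnet.ae_gain_nonneg, hnet.ae_summable_outerTerm hP hα t hb] with ω hh hsum
    by_cases hv : IsVoid X role t a ω
    · rw [if_pos hv]
      have hterm : ∀ i, retention P α s t a b (X i ω, role i ω, h i ω)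
          = Real.exp (-s * outerTerm X role h P α t b ω i) := by
        intro i
        rw [retention, outerTerm]
        by_cases hr : role i ω = t
        · have hn : ¬ ‖X i ω‖ ≤ a := not_le.2 (hv i hr)
          by_cases hX : b < ‖X i ω‖
          · simp only [hr, hn, hX, if_true, if_false, and_self, max_eq_left (hh i)]
            congr 1; ring
          · simp [hr, hn, hX]
        · simp [hr]
      simp_rw [hterm, ← Real.exp_sum, ← Finset.mul_sum]
      exact (Real.continuous_exp.tendsto _).comp (hsum.hasSum.tendsto_sum_nat.const_mul (-s))
    · rw [if_neg hv]
      simp only [IsVoid, not_forall, not_lt] at hv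
      obtain ⟨i, hr, hX⟩ := hv
      refine tendsto_const_nhds.congr' ?_
      filter_upwards [eventually_gt_atTop i] with n hn
      refine (Finset.prod_eq_zero (Finset.mem_range.2 hn) ?_).symm
      simp [retention, hr, hX]

end IsD2DNetwork

end Network

/-! ### The nearest user of a given role -/

section Pathwise

variable {Ω : Type*} {X : ℕ → Ω → Plane} {role : ℕ → Ω → Role} {h : ℕ → Ω → ℝ} {P α : ℝ}
  {t : Role} {ω : Ω}

theorem exists_isNearest (hfin : ∀ R : ℝ, {i | ‖X i ω‖ ≤ R}.Finite) {j : ℕ}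
    (hj : role j ω = t) : ∃ i, IsNearest X role t ω i := by
  have hf : {i | role i ω = t ∧ ‖X i ω‖ ≤ ‖X j ω‖}.Finite := (hfin ‖X j ω‖).subset fun i hi => hi.2
  obtain ⟨i, hi, hmin⟩ := Set.exists_min_image _ (fun i => ‖X i ω‖) hf ⟨j, hj, le_rfl⟩
  refine ⟨i, hi.1, fun k hk => ?_⟩
  rcases le_total ‖X k ω‖ ‖X j ω‖ with hkj | hkj
  · exact hmin k ⟨hk, hkj⟩
  · exact hi.2.trans hkj

theorem IsNearest.linkDist_eq {i : ℕ} (hi : IsNearest X role t ω i) :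
    linkDist X role t ω = ‖X i ω‖ := by
  refine IsLeast.csInf_eq ⟨⟨i, hi.1, rfl⟩, ?_⟩
  rintro _ ⟨j, hj, rfl⟩
  exact hi.2 j hj

theorem IsNearest.isVoid_iff {i : ℕ} (hi : IsNearest X role t ω i) {a : ℝ} :
    IsVoid X role t a ω ↔ a < ‖X i ω‖ :=
  ⟨fun hv => hv i hi.1, fun ha j hj => ha.trans_le (hi.2 j hj)⟩

theorem linkDist_mem_Ioc_iff (hfin : ∀ R : ℝ, {i | ‖X i ω‖ ≤ R}.Finite) {a b : ℝ} (ha : 0 ≤ a) :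
    linkDist X role t ω ∈ Ioc a b ↔ IsVoid X role t a ω ∧ ¬ IsVoid X role t b ω := by
  by_cases hS : ∃ j, role j ω = t
  · obtain ⟨j, hj⟩ := hS
    obtain ⟨i, hi⟩ := exists_isNearest hfin hj
    rw [hi.linkDist_eq, hi.isVoid_iff, hi.isVoid_iff, not_lt, mem_Ioc]
  -- Without users of role `t` the infimum takes the default value 0, which a half-open interval
  -- with 0 ≤ a excludes; this agrees with the disc of radius `b` being void.
  · have h1 : linkDist X role t ω = 0 := by
      have hempty : {i | role i ω = t} = ∅ :=
        eq_empty_iff_forall_notMem.2 fun i hi => hS ⟨i, hi⟩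
      rw [linkDist, hempty, image_empty, Real.sInf_empty]
    refine ⟨fun hm => absurd hm.1 (by rw [h1]; exact not_lt.2 ha), fun hm => ?_⟩
    exact absurd (fun i hi => absurd ⟨i, hi⟩ hS) hm.2

/-- The only user in the annulus must be the unique nearest one of role `t`, so removing it amounts
to removing the disc of radius `b`. Counting users of all roles is wasteful, but that count is
directly Poisson. -/
theorem interferenceTerm_eq_outerTerm {a b : ℝ} (hv : IsVoid X role t a ω)
    (hv' : ¬ IsVoid X role t b ω)
    (hc : ¬ 2 ≤ pointCount X {x | a < ‖x‖ ∧ ‖x‖ ≤ b} ω) (i : ℕ) :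
    interferenceTerm X role h P α t ω i = outerTerm X role h P α t b ω i := by
  simp only [IsVoid, not_forall, not_lt] at hv'
  obtain ⟨k, hk, hkb⟩ := hv'
  have hout : ∀ j, role j ω = t → j ≠ k → b < ‖X j ω‖ := by
    intro j hj hjk
    by_contra hjb
    refine hc ?_
    rw [pointCount]
    have hsub : ({j, k} : Set ℕ) ⊆ {i | X i ω ∈ {x : Plane | a < ‖x‖ ∧ ‖x‖ ≤ b}} := by
      rintro l (rfl | rfl)
      · exact ⟨hv _ hj, not_lt.1 hjb⟩
      · exact ⟨hv _ hk, hkb⟩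
    calc (2 : ℕ∞) = ({j, k} : Set ℕ).encard := (encard_pair hjk).symm
      _ ≤ _ := encard_le_encard hsub
  have hnear : IsNearest X role t ω k := by
    refine ⟨hk, fun j hj => ?_⟩
    rcases eq_or_ne j k with rfl | hjk
    · exact le_rfl
    · exact hkb.trans (hout j hj hjk).le
  rw [interferenceTerm, outerTerm]
  by_cases hi : role i ω = t
  · rcases eq_or_ne i k with rfl | hik
    · simp [hnear, not_lt.2 hkb]
    · have hb := hout i hi hik
      have hn : ¬ IsNearest X role t ω i := fun hn =>
        absurd (hn.2 k hk) (not_le.2 (hkb.trans_lt hb))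
      simp [hi, hb, hn]
  · simp [hi]

theorem interferenceTerm_nonneg (hP : 0 < P) {i : ℕ} (hh : 0 ≤ h i ω) :
    0 ≤ interferenceTerm X role h P α t ω i := by
  rw [interferenceTerm]
  split_ifs
  · positivity
  · exact le_rfl

end Pathwise

/-! ### Joint behaviour of link distance and interference on thin annuli -/

section Network

variable {Ω : Type*} [MeasurableSpace Ω] {μ : Measure Ω}
  {X : ℕ → Ω → Plane} {role : ℕ → Ω → Role} {h : ℕ → Ω → ℝ} {lam pHD pFD P α : ℝ}

namespace IsD2DNetwork

theorem ae_locallyFinite (hnet : IsD2DNetwork X role h lam pHD pFD μ) :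
    ∀ᵐ ω ∂μ, ∀ R : ℝ, {i | ‖X i ω‖ ≤ R}.Finite := by
  have h : ∀ᵐ ω ∂μ, ∀ n : ℕ, {i | ‖X i ω‖ ≤ n}.Finite :=
    ae_all_iff.2 fun n => hnet.ae_finite_ball n
  filter_upwards [h] with ω hω R
  exact (hω ⌈R⌉₊).subset fun i (hi : ‖X i ω‖ ≤ R) => hi.trans (Nat.le_ceil R)

/-- The interference is almost surely finite. -/
theorem ae_summable_interferenceTerm (hnet : IsD2DNetwork X role h lam pHD pFD μ) (hP : 0 < P)
    (hα : 2 < α) (t : Role) : ∀ᵐ ω ∂μ, Summable (interferenceTerm X role h P α t ω) := by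
  filter_upwards [hnet.ae_gain_nonneg, hnet.ae_locallyFinite,
    hnet.ae_summable_outerTerm hP hα t one_pos] with ω hh hfin hsum
  refine Summable.of_norm_bounded_eventually hsum ?_
  -- Only finitely many users lie in the unit disc, so the interference is compared with the outer
  -- terms at radius 1.
  refine ((hfin 1).eventually_cofinite_notMem).mono fun i hi => ?_
  have hi1 : 1 < ‖X i ω‖ := not_le.1 hi
  rw [Real.norm_eq_abs, abs_of_nonneg (interferenceTerm_nonneg hP (hh i)), interferenceTerm,
    outerTerm]
  have : 0 ≤ P * h i ω * ‖X i ω‖ ^ (-α) := by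
    have := hh i
    positivity
  by_cases hr : role i ω = t
  · simp only [hr, true_and, hi1, if_true]
    split_ifs <;> linarith
  · simp [hr]

theorem ae_interference_nonneg (hnet : IsD2DNetwork X role h lam pHD pFD μ) (hP : 0 < P)
    (t : Role) : ∀ᵐ ω ∂μ, 0 ≤ interference X role h P α t ω := by
  filter_upwards [hnet.ae_gain_nonneg] with ω hh
  exact tsum_nonneg fun i => interferenceTerm_nonneg hP (hh i)

theorem aemeasurable_interference (hnet : IsD2DNetwork X role h lam pHD pFD μ) (hP : 0 < P)
    (hα : 2 < α) (t : Role) : AEMeasurable (interference X role h P α t) μ := by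
  classical
  have hterm : ∀ i, Measurable fun ω => interferenceTerm X role h P α t ω i := by
    intro i
    have hr := hnet.measurableSet_role
    have hn := hnet.measurable_norm_position
    have hset : {ω | role i ω = t ∧ ¬ IsNearest X role t ω i}
        = {ω | role i ω = t} ∩ ({ω | role i ω = t}
          ∩ ⋂ j, ({ω | role j ω = t}ᶜ ∪ {ω | ‖X i ω‖ ≤ ‖X j ω‖}))ᶜ := by
      ext ω
      simp only [IsNearest, mem_ofPred_eq, mem_inter_iff, mem_compl_iff, mem_iInter, mem_union,
        imp_iff_not_or]
    refine Measurable.ite ?_ (((hnet.measurable_gain i).const_mul P).mul ((hn i).pow_const _))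
      measurable_const
    rw [hset]
    exact (hr i t).inter ((hr i t).inter (MeasurableSet.iInter fun j =>
      (hr j t).compl.union (measurableSet_le (hn i) (hn j)))).compl
  refine aemeasurable_of_tendsto_metrizable_ae atTop
    (f := fun n ω => ∑ i ∈ Finset.range n, interferenceTerm X role h P α t ω i)
    (fun n => (Finset.measurable_sum _ fun i _ => hterm i).aemeasurable) ?_
  filter_upwards [hnet.ae_summable_interferenceTerm hP hα t] with ω hω
  exact hω.hasSum.tendsto_sum_nat

theorem measurable_linkDist (hnet : IsD2DNetwork X role h lam pHD pFD μ) (t : Role) :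
    Measurable (linkDist X role t) := by
  refine measurable_of_Iio fun c => ?_
  -- The first set accounts for the default infimum 0 when no user has role `t`.
  have hset : linkDist X role t ⁻¹' Iio c
      = ((⋂ i, {ω | role i ω = t}ᶜ) ∩ {_ω | 0 < c})
        ∪ ⋃ i, ({ω | role i ω = t} ∩ {ω | ‖X i ω‖ < c}) := by
    ext ω
    simp only [mem_preimage, mem_Iio, mem_union, mem_inter_iff, mem_iInter, mem_compl_iff,
      mem_ofPred_eq, mem_iUnion]
    by_cases hS : ∃ j, role j ω = t
    · have hne : ((fun i => ‖X i ω‖) '' {i | role i ω = t}).Nonempty := by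
        obtain ⟨j, hj⟩ := hS
        exact ⟨_, j, hj, rfl⟩
      have hbdd : BddBelow ((fun i => ‖X i ω‖) '' {i | role i ω = t}) :=
        ⟨0, by rintro _ ⟨i, _, rfl⟩; exact norm_nonneg _⟩
      rw [linkDist, csInf_lt_iff hbdd hne]
      constructor
      · rintro ⟨_, ⟨i, hi, rfl⟩, hc⟩
        exact Or.inr ⟨i, hi, hc⟩
      · rintro (⟨h1, _⟩ | ⟨i, hi, hc⟩)
        · obtain ⟨j, hj⟩ := hS
          exact absurd hj (h1 j)
        · exact ⟨_, ⟨i, hi, rfl⟩, hc⟩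
    · push Not at hS
      have hempty : {i | role i ω = t} = ∅ :=
        eq_empty_iff_forall_notMem.2 fun i hi => hS i hi
      rw [linkDist, hempty, image_empty, Real.sInf_empty]
      exact ⟨fun hc => Or.inl ⟨hS, hc⟩, fun hc => hc.elim (fun h => h.2)
        fun ⟨i, hi, _⟩ => absurd hi (hS i)⟩
  rw [hset]
  exact ((MeasurableSet.iInter fun i => (hnet.measurableSet_role i t).compl).inter
    (MeasurableSet.const _)).union (MeasurableSet.iUnion fun i =>
      (hnet.measurableSet_role i t).inter
        (measurableSet_lt (hnet.measurable_norm_position i) measurable_const))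

theorem measureReal_two_le_count_annulus (hnet : IsD2DNetwork X role h lam pHD pFD μ)
    (hlam : 0 < lam) {a b : ℝ} (ha : 0 ≤ a) (hab : a ≤ b) :
    NullMeasurableSet {ω | 2 ≤ pointCount X {x | a < ‖x‖ ∧ ‖x‖ ≤ b} ω} μ ∧
    μ.real {ω | 2 ≤ pointCount X {x | a < ‖x‖ ∧ ‖x‖ ≤ b} ω}
      ≤ (lam * Real.pi) ^ 2 * (b ^ 2 - a ^ 2) ^ 2 := by
  have hset : {x : Plane | a < ‖x‖ ∧ ‖x‖ ≤ b}
      = Metric.closedBall 0 b \ Metric.closedBall 0 a := by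
    ext x; simp [and_comm]
  have hm : MeasurableSet {x : Plane | a < ‖x‖ ∧ ‖x‖ ≤ b} := by
    rw [hset]; exact measurableSet_closedBall.diff measurableSet_closedBall
  have hfin : (ENNReal.ofReal lam • (volume : Measure Plane)) {x | a < ‖x‖ ∧ ‖x‖ ≤ b} ≠ ∞ := by
    rw [Measure.smul_apply, smul_eq_mul, hset]
    exact ENNReal.mul_ne_top ENNReal.ofReal_ne_top
      ((measure_mono sdiff_subset).trans_lt measure_closedBall_lt_top).ne
  have hval : (ENNReal.ofReal lam • (volume : Measure Plane)).real {x | a < ‖x‖ ∧ ‖x‖ ≤ b}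
      = lam * (Real.pi * b ^ 2 - Real.pi * a ^ 2) := by
    rw [measureReal_ennreal_smul_apply, ENNReal.toReal_ofReal hlam.le, hset,
      measureReal_sdiff (Metric.closedBall_subset_closedBall hab) measurableSet_closedBall
        measure_closedBall_lt_top.ne, Plane.measureReal_closedBall ha,
      Plane.measureReal_closedBall (ha.trans hab)]
  -- The law of a count gives only almost everywhere measurability, hence a null-measurable event.
  refine ⟨(hnet.poisson.hasLaw_count _ hm hfin).aemeasurable.nullMeasurableSet_preimage
    (s := {k | 2 ≤ k}) .of_discrete, ?_⟩
  refine (hnet.poisson.measureReal_two_le_count hm hfin).trans (le_of_eq ?_)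
  rw [hval]; ring

open Classical in
-- The main term is the difference of the void formula at `a` and at `b`, both with outer radius
-- `b`. Replacing the outer power by the interference matters only when the annulus holds two users,
-- and then changes a quantity in [0, 1].
theorem abs_integral_linkDist_mem_Ioc_sub_le [IsProbabilityMeasure μ]
    (hnet : IsD2DNetwork X role h lam pHD pFD μ) (hlam : 0 < lam)
    (hP : 0 < P) (hα : 2 < α) {s : ℝ} (hs : 0 ≤ s) (t : Role)
    (hp : roleProb pHD pFD t ∈ Icc (0 : ℝ) 1) {a b : ℝ} (ha : 0 < a) (hab : a ≤ b) :
    |(∫ ω in linkDist X role t ⁻¹' Ioc a b, Real.exp (-s * interference X role h P α t ω) ∂μ)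
      - (Real.exp (-(lam * roleProb pHD pFD t * Real.pi * a ^ 2))
          - Real.exp (-(lam * roleProb pHD pFD t * Real.pi * b ^ 2)))
        * Real.exp (-2 * Real.pi * (lam * roleProb pHD pFD t) * interferenceExponent P α s b)|
      ≤ (lam * Real.pi) ^ 2 * (b ^ 2 - a ^ 2) ^ 2 := by
  have hb : 0 < b := ha.trans_le hab
  set J : Ω → ℝ := fun ω => ∑' i, outerTerm X role h P α t b ω i with hJ
  have hJm : Measurable J := Measurable.tsum fun i => hnet.measurable_outerTerm t b i
  have hvm : ∀ c, MeasurableSet {ω | IsVoid X role t c ω} := by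
    intro c
    have : {ω | IsVoid X role t c ω} = ⋂ i, ({ω | role i ω = t}ᶜ ∪ {ω | c < ‖X i ω‖}) := by
      ext ω; simp only [IsVoid, mem_ofPred_eq, mem_iInter, mem_union, mem_compl_iff,
        imp_iff_not_or]
    rw [this]
    exact MeasurableSet.iInter fun i => (hnet.measurableSet_role i t).compl.union
      (measurableSet_lt measurable_const (hnet.measurable_norm_position i))
  have hJ0 : ∀ᵐ ω ∂μ, 0 ≤ J ω := by
    filter_upwards [hnet.ae_gain_nonneg] with ω hh
    exact tsum_nonneg fun i => outerTerm_nonneg hP (hh i)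
  have hEJ : Integrable (fun ω => Real.exp (-s * J ω)) μ := by
    refine Integrable.of_bound (C := 1) (by fun_prop) ?_
    filter_upwards [hJ0] with ω hω
    rw [Real.norm_eq_abs, Real.abs_exp]
    exact Real.exp_le_one_iff.2 (by nlinarith)
  have hEI : Integrable (fun ω => Real.exp (-s * interference X role h P α t ω)) μ := by
    have := hnet.aemeasurable_interference hP hα t
    refine Integrable.of_bound (C := 1)
      (Real.measurable_exp.comp_aemeasurable (this.const_mul (-s))).aestronglyMeasurable ?_
    filter_upwards [hnet.ae_interference_nonneg hP t] with ω hω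
    rw [Real.norm_eq_abs, Real.abs_exp]
    exact Real.exp_le_one_iff.2 (by nlinarith)
  have hvi : ∀ c, Integrable (fun ω => if IsVoid X role t c ω then Real.exp (-s * J ω) else 0) μ := by
    intro c
    have := hEJ.indicator (hvm c)
    exact this
  have hA : MeasurableSet (linkDist X role t ⁻¹' Ioc a b) :=
    hnet.measurable_linkDist t measurableSet_Ioc
  have hJint : ∫ ω in linkDist X role t ⁻¹' Ioc a b, Real.exp (-s * J ω) ∂μ
      = (Real.exp (-(lam * roleProb pHD pFD t * Real.pi * a ^ 2))
          - Real.exp (-(lam * roleProb pHD pFD t * Real.pi * b ^ 2)))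
        * Real.exp (-2 * Real.pi * (lam * roleProb pHD pFD t)
          * interferenceExponent P α s b) := by
    rw [sub_mul, ← hnet.integral_void_mul_exp hlam hP hα hs t hp ha.le hab hb,
      ← hnet.integral_void_mul_exp hlam hP hα hs t hp hb.le le_rfl hb,
      ← integral_sub (hvi a) (hvi b), ← integral_indicator hA]
    refine integral_congr_ae ?_
    filter_upwards [hnet.ae_locallyFinite] with ω hfin
    have hiff := linkDist_mem_Ioc_iff (role := role) (t := t) hfin (a := a) (b := b) ha.le
    have himp : IsVoid X role t b ω → IsVoid X role t a ω := fun hv i hi => hab.trans_lt (hv i hi)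
    by_cases h1 : IsVoid X role t a ω
    · by_cases h2 : IsVoid X role t b ω
      · have hn : ω ∉ linkDist X role t ⁻¹' Ioc a b := fun hm => (hiff.1 hm).2 h2
        rw [indicator_of_notMem hn, if_pos h1, if_pos h2, sub_self]
      · have hn : ω ∈ linkDist X role t ⁻¹' Ioc a b := hiff.2 ⟨h1, h2⟩
        rw [indicator_of_mem hn, if_pos h1, if_neg h2, sub_zero]
    · have h2 : ¬ IsVoid X role t b ω := fun hv => h1 (himp hv)
      have hn : ω ∉ linkDist X role t ⁻¹' Ioc a b := fun hm => h1 (hiff.1 hm).1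
      rw [indicator_of_notMem hn, if_neg h1, if_neg h2, sub_self]
  obtain ⟨hnull, hle⟩ := hnet.measureReal_two_le_count_annulus hlam ha.le hab
  rw [← hJint, ← integral_sub hEI.integrableOn hEJ.integrableOn]
  refine (abs_integral_le_integral_abs.trans ?_).trans hle
  have hone : ∫ ω, {ω | 2 ≤ pointCount X {x | a < ‖x‖ ∧ ‖x‖ ≤ b} ω}.indicator (1 : Ω → ℝ) ω ∂μ
      = μ.real {ω | 2 ≤ pointCount X {x | a < ‖x‖ ∧ ‖x‖ ≤ b} ω} := by
    rw [integral_indicator₀ hnull]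
    simp
  rw [← integral_indicator hA, ← hone]
  refine integral_mono_ae ((hEI.sub hEJ).abs.indicator hA)
    ((integrable_const (1 : ℝ)).indicator₀ hnull) ?_
  filter_upwards [hnet.ae_locallyFinite, hnet.ae_interference_nonneg hP t, hJ0] with ω hfin hI0 hJ0
  by_cases hm : ω ∈ linkDist X role t ⁻¹' Ioc a b
  · rw [indicator_of_mem hm]
    by_cases hc : 2 ≤ pointCount X {x | a < ‖x‖ ∧ ‖x‖ ≤ b} ω
    · rw [indicator_of_mem (show ω ∈ {ω | 2 ≤ pointCount X {x | a < ‖x‖ ∧ ‖x‖ ≤ b} ω} from hc)]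
      have h1 : Real.exp (-s * interference X role h P α t ω) ≤ 1 :=
        Real.exp_le_one_iff.2 (by nlinarith)
      have h2 : Real.exp (-s * J ω) ≤ 1 := Real.exp_le_one_iff.2 (by nlinarith)
      have h3 := Real.exp_pos (-s * interference X role h P α t ω)
      have h4 := Real.exp_pos (-s * J ω)
      exact abs_le.2 ⟨by simp only [Pi.one_apply]; linarith, by simp only [Pi.one_apply]; linarith⟩
    · obtain ⟨hv, hv'⟩ := (linkDist_mem_Ioc_iff hfin ha.le).1 hm
      have : interference X role h P α t ω = J ω :=
        tsum_congr fun i => interferenceTerm_eq_outerTerm hv hv' hc i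
      rw [this, sub_self, abs_zero]
      exact indicator_nonneg (fun _ _ => zero_le_one) _
  · rw [indicator_of_notMem hm]
    exact indicator_nonneg (fun _ _ => zero_le_one) _

end IsD2DNetwork

end Network

/-! ### From increments to densities -/

/-- Dividing by the step, the slope of `F` is the slope of `E` times a value of `L`, up to an error
of first order in the step. -/
theorem hasDerivAt_of_abs_increment_sub_le {F E L : ℝ → ℝ} {C e' r : ℝ} (hr : 0 < r)
    (hF : ∀ a b, 0 < a → a ≤ b → |F b - F a - (E b - E a) * L b| ≤ C * (b ^ 2 - a ^ 2) ^ 2)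
    (hE : HasDerivAt E e' r) (hL : ContinuousAt L r) : HasDerivAt F (e' * L r) r := by
  rw [hasDerivAt_iff_tendsto_slope] at hE ⊢
  -- The estimate evaluates `L` at the right endpoint, which is max y r since y may lie on either
  -- side of r.
  have hM : Tendsto (fun y => L (max y r)) (𝓝[≠] r) (𝓝 (L r)) := by
    have hmax : Tendsto (fun y => max y r) (𝓝 r) (𝓝 r) := by
      have h : Continuous fun y : ℝ => max y r := by fun_prop
      simpa using h.tendsto r
    exact (hL.tendsto.comp hmax).mono_left nhdsWithin_le_nhds
  have hbound : Tendsto (fun y => C * ((y + r) ^ 2 * |y - r|)) (𝓝[≠] r) (𝓝 0) := by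
    have h : Continuous fun y : ℝ => C * ((y + r) ^ 2 * |y - r|) := by fun_prop
    have h2 := h.tendsto r
    simp only [sub_self, abs_zero, mul_zero] at h2
    exact h2.mono_left nhdsWithin_le_nhds
  have hdiff : Tendsto (fun y => slope F r y - slope E r y * L (max y r)) (𝓝[≠] r) (𝓝 0) := by
    refine squeeze_zero_norm' ?_ hbound
    filter_upwards [self_mem_nhdsWithin, mem_nhdsWithin_of_mem_nhds (lt_mem_nhds hr)] with y hy hy0
    have hyr : y - r ≠ 0 := sub_ne_zero.2 hy
    have hkey : |F y - F r - (E y - E r) * L (max y r)| ≤ C * (y ^ 2 - r ^ 2) ^ 2 := by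
      rcases le_total y r with hle | hle
      · rw [max_eq_right hle]
        have h := hF y r hy0 hle
        rw [← abs_neg]
        convert h using 1
        · congr 1; ring
        · ring
      · rw [max_eq_left hle]
        exact hF r y hr hle
    rw [slope_def_field, slope_def_field, Real.norm_eq_abs]
    have hrw : (F y - F r) / (y - r) - (E y - E r) / (y - r) * L (max y r)
        = (F y - F r - (E y - E r) * L (max y r)) / (y - r) := by
      field_simp
    rw [hrw, abs_div, div_le_iff₀ (abs_pos.2 hyr)]
    refine hkey.trans (le_of_eq ?_)
    have : |y - r| * |y - r| = (y - r) ^ 2 := by rw [abs_mul_abs_self]; ring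
    calc C * (y ^ 2 - r ^ 2) ^ 2 = C * ((y + r) ^ 2 * (y - r) ^ 2) := by ring
      _ = _ := by rw [← this]; ring
  have h := hdiff.add (hE.mul hM)
  simpa using h

/-- The distribution function is differentiable with continuous derivative E' L, so the fundamental
theorem of calculus gives the masses of half-open intervals, which determine the measure. Cutting at
ε leaves only intervals with positive left endpoint, to which the increment bound applies. -/
theorem restrict_Ioi_eq_withDensity {ν : Measure ℝ} [IsFiniteMeasure ν] {E E' L : ℝ → ℝ} {C : ℝ}
    (hν : ∀ a b, 0 < a → a ≤ b → |ν.real (Ioc a b) - (E b - E a) * L b| ≤ C * (b ^ 2 - a ^ 2) ^ 2)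
    (hE : ∀ r, 0 < r → HasDerivAt E (E' r) r) (hE' : ContinuousOn E' (Ioi 0))
    (hL : ContinuousOn L (Ioi 0)) (hpos : ∀ r, 0 < r → 0 ≤ E' r * L r) {ε : ℝ} (hε : 0 < ε) :
    ν.restrict (Ioi ε)
      = (volume.restrict (Ioi ε)).withDensity fun r => ENNReal.ofReal (E' r * L r) := by
  have hg : ContinuousOn (fun r => E' r * L r) (Ioi 0) := hE'.mul hL
  have hinc : ∀ a b, a ≤ b → ν.real (Iic b) - ν.real (Iic a) = ν.real (Ioc a b) := by
    intro a b hab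
    rw [← Iic_union_Ioc_eq_Iic hab, measureReal_union (Iic_disjoint_Ioc le_rfl) measurableSet_Ioc]
    ring
  have hder : ∀ r, 0 < r → HasDerivAt (fun r => ν.real (Iic r)) (E' r * L r) r := fun r hr =>
    hasDerivAt_of_abs_increment_sub_le hr
      (fun a b ha hab => by rw [hinc a b hab]; exact hν a b ha hab) (hE r hr)
      (hL.continuousAt (Ioi_mem_nhds hr))
  have hIoc : ∀ a b, 0 < a → a ≤ b →
      ν (Ioc a b) = ∫⁻ r in Ioc a b, ENNReal.ofReal (E' r * L r) := by
    intro a b ha hab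
    have hsub : Icc a b ⊆ Ioi 0 := fun x hx => ha.trans_le hx.1
    have hint : IntervalIntegrable (fun r => E' r * L r) volume a b := by
      refine ContinuousOn.intervalIntegrable ?_
      rw [uIcc_of_le hab]
      exact hg.mono hsub
    have hftc := intervalIntegral.integral_eq_sub_of_hasDerivAt
      (f := fun r => ν.real (Iic r)) (fun x hx => hder x (hsub (uIcc_of_le hab ▸ hx))) hint
    rw [hinc a b hab, intervalIntegral.integral_of_le hab] at hftc
    rw [← ofReal_measureReal, ← hftc, ofReal_integral_eq_lintegral_ofReal
      ((intervalIntegrable_iff_integrableOn_Ioc_of_le hab).1 hint)]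
    filter_upwards [ae_restrict_mem measurableSet_Ioc] with x hx
    exact hpos x (ha.trans hx.1)
  refine Measure.ext_of_Ioc _ _ fun a b _ => ?_
  rw [Measure.restrict_apply measurableSet_Ioc, withDensity_apply _ measurableSet_Ioc,
    Measure.restrict_restrict measurableSet_Ioc, Ioc_inter_Ioi]
  rcases le_total (a ⊔ ε) b with hle | hle
  · exact hIoc _ _ (lt_sup_of_lt_right hε) hle
  · simp [Ioc_eq_empty (not_lt.2 hle)]

/-! ### Conditional Laplace transforms -/

section Conditional

variable {Ω : Type*} [MeasurableSpace Ω] {μ : Measure Ω}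

/-- This is the disintegration of the joint law of (R, I) over the law of R, tested on functions of
I restricted to R ∈ A. -/
theorem map_withDensity_eq_withDensity_condDistrib [IsProbabilityMeasure μ] {R I : Ω → ℝ}
    (hR : Measurable R) (hI : AEMeasurable I μ) {f : ℝ → ℝ≥0∞} (hf : Measurable f) :
    (μ.withDensity fun ω => f (I ω)).map R
      = (μ.map R).withDensity fun r => ∫⁻ y, f y ∂(condDistrib I R μ r) := by
  ext A hA
  have hm : Measurable ((A ×ˢ (univ : Set ℝ)).indicator fun z : ℝ × ℝ => f z.2) :=
    (hf.comp measurable_snd).indicator (hA.prod .univ)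
  rw [Measure.map_apply hR hA, withDensity_apply _ (hR hA), withDensity_apply _ hA,
    ← lintegral_indicator (hR hA), ← lintegral_indicator hA]
  calc ∫⁻ ω, (R ⁻¹' A).indicator (fun ω => f (I ω)) ω ∂μ
      = ∫⁻ z, (A ×ˢ (univ : Set ℝ)).indicator (fun z : ℝ × ℝ => f z.2) z
          ∂(μ.map fun ω => (R ω, I ω)) := by
        rw [lintegral_map' hm.aemeasurable (hR.aemeasurable.prodMk hI)]
        refine lintegral_congr fun ω => ?_
        by_cases hω : R ω ∈ A <;> simp [indicator, hω]
    _ = ∫⁻ r, ∫⁻ y, (A ×ˢ (univ : Set ℝ)).indicator (fun z : ℝ × ℝ => f z.2) (r, y)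
          ∂(condDistrib I R μ r) ∂(μ.map R) := by
        rw [← compProd_map_condDistrib hI, Measure.lintegral_compProd hm]
    _ = _ := by
        refine lintegral_congr fun r => ?_
        by_cases hr : r ∈ A <;> simp [indicator, hr]

theorem restrict_Ioi_map_withDensity {R g : Ω → ℝ} (hR : Measurable R) (hg0 : ∀ ω, 0 ≤ g ω)
    (hgi : Integrable g μ) {E E' L : ℝ → ℝ} {C : ℝ}
    (hinc : ∀ a b, 0 < a → a ≤ b →
      |(∫ ω in R ⁻¹' Ioc a b, g ω ∂μ) - (E b - E a) * L b| ≤ C * (b ^ 2 - a ^ 2) ^ 2)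
    (hE : ∀ r, 0 < r → HasDerivAt E (E' r) r) (hE' : ContinuousOn E' (Ioi 0))
    (hL : ContinuousOn L (Ioi 0)) (hpos : ∀ r, 0 < r → 0 ≤ E' r * L r) {ε : ℝ} (hε : 0 < ε) :
    ((μ.withDensity fun ω => ENNReal.ofReal (g ω)).map R).restrict (Ioi ε)
      = (volume.restrict (Ioi ε)).withDensity fun r => ENNReal.ofReal (E' r * L r) := by
  have : IsFiniteMeasure (μ.withDensity fun ω => ENNReal.ofReal (g ω)) :=
    isFiniteMeasure_withDensity_ofReal hgi.2
  refine restrict_Ioi_eq_withDensity (C := C) (fun a b ha hab => ?_) hE hE' hL hpos hε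
  rw [map_measureReal_apply hR measurableSet_Ioc, measureReal_def,
    withDensity_apply _ (hR measurableSet_Ioc),
    ← integral_eq_lintegral_of_nonneg_ae (ae_of_all _ fun ω => hg0 _)
      hgi.aestronglyMeasurable.restrict]
  exact hinc a b ha hab

/-- E' k and E' L are densities of one measure, hence almost everywhere equal, and E' > 0 cancels.
-/
theorem ae_eq_of_withDensity_withDensity {ρ : Measure ℝ} {E' L : ℝ → ℝ} {k : ℝ → ℝ≥0∞}
    (hk : Measurable k) {ε : ℝ} (hε : 0 < ε)
    (hρ : ρ.restrict (Ioi ε)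
      = (volume.restrict (Ioi ε)).withDensity fun r => ENNReal.ofReal (E' r))
    (hρk : (ρ.withDensity k).restrict (Ioi ε)
      = (volume.restrict (Ioi ε)).withDensity fun r => ENNReal.ofReal (E' r * L r))
    (hE' : ContinuousOn E' (Ioi 0)) (hL : ContinuousOn L (Ioi 0)) (hEpos : ∀ r, 0 < r → 0 < E' r) :
    ∀ᵐ r ∂(volume.restrict (Ioi ε)), k r = ENNReal.ofReal (L r) := by
  have hdm : AEMeasurable (fun r => ENNReal.ofReal (E' r)) (volume.restrict (Ioi ε)) :=
    ((hE'.mono (Ioi_subset_Ioi hε.le)).aemeasurable measurableSet_Ioi).ennreal_ofReal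
  have hLm : AEMeasurable (fun r => ENNReal.ofReal (E' r * L r)) (volume.restrict (Ioi ε)) :=
    (((hE'.mul hL).mono (Ioi_subset_Ioi hε.le)).aemeasurable measurableSet_Ioi).ennreal_ofReal
  rw [restrict_withDensity measurableSet_Ioi, hρ, ← withDensity_mul₀ hdm hk.aemeasurable] at hρk
  have hae := (withDensity_eq_iff_of_sigmaFinite (hdm.mul hk.aemeasurable) hLm).1 hρk
  filter_upwards [hae, ae_restrict_mem measurableSet_Ioi] with r hr hrε
  have hr' := hEpos r (hε.trans hrε)
  rw [Pi.mul_apply, ENNReal.ofReal_mul hr'.le] at hr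
  exact (ENNReal.mul_right_inj (ENNReal.ofReal_pos.2 hr').ne' ENNReal.ofReal_ne_top).1 hr

/-- If `E[1{R ∈ (a, b]} f(I)]` is, up to a second order error, the increment of `E` over `(a, b]`
times `L b`, and likewise for `P(R ∈ (a, b])` with `L = 1`, then `L` is the conditional
expectation of `f(I)` given `R`. -/
theorem ae_integral_condDistrib_eq [IsProbabilityMeasure μ] {R I : Ω → ℝ}
    (hR : Measurable R) (hI : AEMeasurable I μ) {f : ℝ → ℝ} (hf : Measurable f) (hf0 : ∀ y, 0 ≤ f y)
    (hfi : Integrable (fun ω => f (I ω)) μ) {E E' L : ℝ → ℝ} {C : ℝ}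
    (h1 : ∀ a b, 0 < a → a ≤ b →
      |(∫ _ω in R ⁻¹' Ioc a b, (1 : ℝ) ∂μ) - (E b - E a)| ≤ C * (b ^ 2 - a ^ 2) ^ 2)
    (h2 : ∀ a b, 0 < a → a ≤ b →
      |(∫ ω in R ⁻¹' Ioc a b, f (I ω) ∂μ) - (E b - E a) * L b| ≤ C * (b ^ 2 - a ^ 2) ^ 2)
    (hE : ∀ r, 0 < r → HasDerivAt E (E' r) r) (hE' : ContinuousOn E' (Ioi 0))
    (hL : ContinuousOn L (Ioi 0)) (hEpos : ∀ r, 0 < r → 0 < E' r) (hLpos : ∀ r, 0 < r → 0 ≤ L r)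
    {ε : ℝ} (hε : 0 < ε) :
    (volume.restrict (Ioi ε) ≪ μ.map R) ∧
    ∀ᵐ r ∂(volume.restrict (Ioi ε)), ∫ y, f y ∂(condDistrib I R μ r) = L r := by
  have hρ : (μ.map R).restrict (Ioi ε)
      = (volume.restrict (Ioi ε)).withDensity fun r => ENNReal.ofReal (E' r) := by
    have h := restrict_Ioi_map_withDensity (g := fun _ => 1) (L := fun _ => 1) hR
      (fun _ => zero_le_one) (integrable_const (μ := μ) _)
      (fun a b ha hab => by rw [mul_one]; exact h1 a b ha hab) hE hE' continuousOn_const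
      (fun r hr => by rw [mul_one]; exact (hEpos r hr).le) hε
    simpa using h
  refine ⟨?_, ?_⟩
  -- A positive density makes Lebesgue measure beyond ε absolutely continuous with respect to the
  -- law of R, so null sets of that law are Lebesgue null there.
  · have hdm : AEMeasurable (fun r => ENNReal.ofReal (E' r)) (volume.restrict (Ioi ε)) :=
      ((hE'.mono (Ioi_subset_Ioi hε.le)).aemeasurable measurableSet_Ioi).ennreal_ofReal
    have hac := withDensity_absolutelyContinuous' hdm (by
      filter_upwards [ae_restrict_mem measurableSet_Ioi] with r hr
      exact (ENNReal.ofReal_pos.2 (hEpos r (hε.trans hr))).ne')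
    rw [← hρ] at hac
    exact hac.trans (Measure.absolutelyContinuous_of_le Measure.restrict_le_self)
  have hν := restrict_Ioi_map_withDensity hR (fun ω => hf0 (I ω)) hfi h2 hE hE' hL
    (fun r hr => mul_nonneg (hEpos r hr).le (hLpos r hr)) hε
  rw [map_withDensity_eq_withDensity_condDistrib hR hI hf.ennreal_ofReal] at hν
  filter_upwards [ae_eq_of_withDensity_withDensity
    (Measurable.lintegral_kernel hf.ennreal_ofReal) hε hρ hν hE' hL hEpos,
    ae_restrict_mem measurableSet_Ioi] with r hr hrε
  rw [integral_eq_lintegral_of_nonneg_ae (ae_of_all _ hf0) hf.aestronglyMeasurable, hr,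
    ENNReal.toReal_ofReal (hLpos r (hε.trans hrε))]

end Conditional

/-! ### The Laplace transform of the interference -/

section Network

variable {Ω : Type*} [MeasurableSpace Ω] {μ : Measure Ω} [IsProbabilityMeasure μ]
  {X : ℕ → Ω → Plane} {role : ℕ → Ω → Role} {h : ℕ → Ω → ℝ} {lam pHD pFD P α : ℝ}

namespace IsD2DNetwork

theorem ae_interferenceLaplace_eq_of_lt (hnet : IsD2DNetwork X role h lam pHD pFD μ)
    (hlam : 0 < lam) (hP : 0 < P) (hα : 2 < α) {s : ℝ} (hs : 0 ≤ s) (t : Role)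
    (hp : roleProb pHD pFD t ∈ Ioc (0 : ℝ) 1) {ε : ℝ} (hε : 0 < ε) :
    (volume.restrict (Ioi ε) ≪ μ.map (linkDist X role t)) ∧
    ∀ᵐ r ∂(volume.restrict (Ioi ε)), interferenceLaplace X role h P α t μ r s
      = Real.exp (-2 * Real.pi * (lam * roleProb pHD pFD t) * interferenceExponent P α s r) := by
  have hp' : roleProb pHD pFD t ∈ Icc (0 : ℝ) 1 := ⟨hp.1.le, hp.2⟩
  set c := lam * roleProb pHD pFD t with hc
  have hc0 : 0 < c := mul_pos hlam hp.1
  have hIm := hnet.aemeasurable_interference hP hα t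
  refine ae_integral_condDistrib_eq (f := fun y => Real.exp (-s * y)) (hnet.measurable_linkDist t)
    hIm (by fun_prop)
    (fun y => (Real.exp_pos _).le) ?_ (C := (lam * Real.pi) ^ 2)
    (E := fun r => -Real.exp (-(c * Real.pi * r ^ 2)))
    (E' := fun r => 2 * Real.pi * c * r * Real.exp (-(c * Real.pi * r ^ 2)))
    (L := fun r => Real.exp (-2 * Real.pi * c * interferenceExponent P α s r))
    (fun a b ha hab => ?_) (fun a b ha hab => ?_) (fun r _ => ?_) (by fun_prop) ?_
    (fun r hr => by positivity) (fun r _ => (Real.exp_pos _).le) hε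
  · refine Integrable.of_bound (C := 1)
      (Real.measurable_exp.comp_aemeasurable (hIm.const_mul (-s))).aestronglyMeasurable ?_
    filter_upwards [hnet.ae_interference_nonneg hP t] with ω hω
    rw [Real.norm_eq_abs, Real.abs_exp]
    exact Real.exp_le_one_iff.2 (by nlinarith)
  -- Taking s = 0 in the increment estimate describes the law of the link distance itself.
  · have h := hnet.abs_integral_linkDist_mem_Ioc_sub_le hlam hP hα le_rfl t hp' ha hab
    simp only [neg_zero, zero_mul, Real.exp_zero, interferenceExponent_zero, mul_zero, mul_one] at h
    rwa [neg_sub_neg]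
  · have h := hnet.abs_integral_linkDist_mem_Ioc_sub_le hlam hP hα hs t hp' ha hab
    rwa [neg_sub_neg]
  · have h := ((((hasDerivAt_pow 2 r).const_mul (c * Real.pi)).neg).exp).neg
    refine h.congr_deriv ?_
    simp only [Pi.neg_apply]
    push_cast
    ring
  · exact Real.continuous_exp.comp_continuousOn
      (continuousOn_const.mul (continuousOn_interferenceExponent hP hα hs))

/-- The Laplace transform of the interference from the users of role `t`, given the distance to the
nearest of them. -/
theorem ae_interferenceLaplace_eq (hnet : IsD2DNetwork X role h lam pHD pFD μ)
    (hlam : 0 < lam) (hP : 0 < P) (hα : 2 < α) (t : Role)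
    (hp : roleProb pHD pFD t ∈ Ioc (0 : ℝ) 1) :
    ∀ᵐ r ∂(volume.restrict (Ioi (0 : ℝ))), ∀ s, 0 ≤ s →
      interferenceLaplace X role h P α t μ r s
        = Real.exp (-2 * Real.pi * (lam * roleProb pHD pFD t)
          * interferenceExponent P α s r) := by
  have hU : Ioi (0 : ℝ) = ⋃ n : ℕ, Ioi (1 / ((n : ℝ) + 1)) := by
    ext x
    simp only [mem_Ioi, mem_iUnion]
    exact ⟨exists_nat_one_div_lt, fun ⟨n, hn⟩ => lt_trans (by positivity) hn⟩
  rw [hU, ae_restrict_iUnion_iff]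
  intro n
  have hε : (0 : ℝ) < 1 / ((n : ℝ) + 1) := by positivity
  set ε := 1 / ((n : ℝ) + 1)
  -- The exceptional null set depends on s; countably many positive rationals share one.
  have hrat : ∀ᵐ r ∂(volume.restrict (Ioi ε)), ∀ q : ℚ, 0 < (q : ℝ) →
      interferenceLaplace X role h P α t μ r q
        = Real.exp (-2 * Real.pi * (lam * roleProb pHD pFD t)
          * interferenceExponent P α q r) := by
    rw [ae_all_iff]
    intro q
    by_cases hq : 0 < (q : ℝ)
    · filter_upwards [(hnet.ae_interferenceLaplace_eq_of_lt hlam hP hα hq.le t hp hε).2]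
        with r hr _ using hr
    · exact ae_of_all _ fun r h => absurd h hq
  -- Conditional laws carried by [0, ∞) allow domination of exp(-s y) by 1, hence continuity in s up
  -- to s = 0.
  have hnonneg : ∀ᵐ r ∂(volume.restrict (Ioi ε)),
      ∀ᵐ y ∂(condDistrib (interference X role h P α t) (linkDist X role t) μ r), 0 ≤ y := by
    refine (hnet.ae_interferenceLaplace_eq_of_lt hlam hP hα le_rfl t hp hε).1.ae_le ?_
    have hIm := hnet.aemeasurable_interference hP hα t
    refine Measure.ae_ae_of_ae_compProd (p := fun z : ℝ × ℝ => 0 ≤ z.2) ?_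
    rw [compProd_map_condDistrib hIm, ae_map_iff
      ((hnet.measurable_linkDist t).aemeasurable.prodMk hIm)
      (measurableSet_le measurable_const measurable_snd)]
    exact hnet.ae_interference_nonneg hP t
  filter_upwards [hrat, hnonneg, ae_restrict_mem measurableSet_Ioi] with r hr hy hrε
  have hr0 : 0 < r := hε.trans hrε
  have hcont : ContinuousOn (fun s => interferenceLaplace X role h P α t μ r s) (Ici 0) := by
    intro s _
    refine continuousWithinAt_of_dominated (bound := fun _ => 1)
      (Eventually.of_forall fun s => by fun_prop) ?_ (integrable_const _)
      (ae_of_all _ fun y => by fun_prop)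
    filter_upwards [self_mem_nhdsWithin] with u hu
    filter_upwards [hy] with y hy
    rw [Real.norm_eq_abs, Real.abs_exp]
    exact Real.exp_le_one_iff.2 (by nlinarith [mem_Ici.1 hu])
  have hcont' : ContinuousOn (fun s => Real.exp (-2 * Real.pi * (lam * roleProb pHD pFD t)
      * interferenceExponent P α s r)) (Ici 0) :=
    Real.continuous_exp.comp_continuousOn
      (continuousOn_const.mul (continuousOn_interferenceExponent_param hP hα hr0))
  have hEq : EqOn (fun s => interferenceLaplace X role h P α t μ r s)
      (fun s => Real.exp (-2 * Real.pi * (lam * roleProb pHD pFD t)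
        * interferenceExponent P α s r)) (Ioi 0 ∩ range ((↑) : ℚ → ℝ)) := by
    rintro _ ⟨hq, q, rfl⟩
    exact hr q hq
  have hcl : Ici (0 : ℝ) ⊆ closure (Ioi 0 ∩ range ((↑) : ℚ → ℝ)) := by
    rw [← closure_Ioi (0 : ℝ)]
    exact closure_minimal (Rat.denseRange_cast.open_subset_closure_inter isOpen_Ioi)
      isClosed_closure
  have hall := hEq.of_subset_closure hcont hcont' (fun x hx => mem_Ici.2 (mem_Ioi.1 hx.1).le) hcl
  exact fun s hs => hall (mem_Ici.2 hs)

end IsD2DNetwork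

end Network

end

/-! ### Half-duplex and full-duplex interference -/

theorem corollary1 {Ω : Type*} [MeasurableSpace Ω] (μ : Measure Ω) [IsProbabilityMeasure μ]
    (X : ℕ → Ω → Plane) (role : ℕ → Ω → Role) (h : ℕ → Ω → ℝ)
    (lam pHD pFD lamHD lamFD P α : ℝ) (hlam : 0 < lam)
    (hHD : 0 ≤ pHD) (hFD : 0 ≤ pFD) (hsum : pHD + pFD = 1)
    (hlamHD : lamHD = 1 / 2 * lam * pHD) (hlamFD : lamFD = lam * pFD)
    (hP : 0 < P) (hα : 2 < α) (hnet : IsD2DNetwork X role h lam pHD pFD μ) :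
    (0 < pHD →
      (∀ᵐ ω ∂μ, Summable (interferenceTerm X role h P α Role.hdTx ω)) ∧
      ∀ᵐ r ∂(volume.restrict (Ioi (0 : ℝ))),
        (∀ s : ℝ, 0 ≤ s →
          interferenceLaplace X role h P α Role.hdTx μ r s =
            Real.exp (-2 * Real.pi * lamHD *
              ∫ x in Ioi r, s * P * x ^ (-α) / (1 + s * P * x ^ (-α)) * x)) ∧
        (α = 4 → ∀ β : ℝ, 0 ≤ β →
          interferenceLaplace X role h P α Role.hdTx μ r (β * r ^ 4 / P) =
            Real.exp (-Real.pi * lamHD * r ^ 2 * Real.sqrt β * Real.arctan (Real.sqrt β)))) ∧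
    (0 < pFD →
      (∀ᵐ ω ∂μ, Summable (interferenceTerm X role h P α Role.fd ω)) ∧
      ∀ᵐ r ∂(volume.restrict (Ioi (0 : ℝ))),
        (∀ s : ℝ, 0 ≤ s →
          interferenceLaplace X role h P α Role.fd μ r s =
            Real.exp (-2 * Real.pi * lamFD *
              ∫ x in Ioi r, s * P * x ^ (-α) / (1 + s * P * x ^ (-α)) * x)) ∧
        (α = 4 → ∀ β : ℝ, 0 ≤ β →
          interferenceLaplace X role h P α Role.fd μ r (β * r ^ 4 / P) =
            Real.exp (-Real.pi * lamFD * r ^ 2 * Real.sqrt β * Real.arctan (Real.sqrt β)))) := by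
  -- Both types are instances of one statement: the density of each is `lam` times the probability
  -- of its role, which is `pHD / 2` for half-duplex transmitters.
  have key : ∀ (t : Role) (lamT : ℝ), lamT = lam * roleProb pHD pFD t →
      roleProb pHD pFD t ∈ Ioc (0 : ℝ) 1 →
      (∀ᵐ ω ∂μ, Summable (interferenceTerm X role h P α t ω)) ∧
      ∀ᵐ r ∂(volume.restrict (Ioi (0 : ℝ))),
        (∀ s : ℝ, 0 ≤ s →
          interferenceLaplace X role h P α t μ r s =
            Real.exp (-2 * Real.pi * lamT *
              ∫ x in Ioi r, s * P * x ^ (-α) / (1 + s * P * x ^ (-α)) * x)) ∧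
        (α = 4 → ∀ β : ℝ, 0 ≤ β →
          interferenceLaplace X role h P α t μ r (β * r ^ 4 / P) =
            Real.exp (-Real.pi * lamT * r ^ 2 * Real.sqrt β * Real.arctan (Real.sqrt β))) := by
    rintro t _ rfl hp
    refine ⟨hnet.ae_summable_interferenceTerm hP hα t, ?_⟩
    filter_upwards [hnet.ae_interferenceLaplace_eq hlam hP hα t hp,
      ae_restrict_mem measurableSet_Ioi] with r hr hr0
    refine ⟨hr, ?_⟩
    rintro rfl β hβ
    have hr0' : 0 < r := hr0
    rw [hr _ (by positivity), interferenceExponent_four hP hr0' hβ]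
    congr 1
    ring
  refine ⟨fun hpos => key Role.hdTx lamHD ?_ ?_, fun hpos => key Role.fd lamFD hlamFD ?_⟩
  · rw [hlamHD, roleProb]; ring
  · exact ⟨half_pos hpos, by rw [roleProb]; linarith⟩
  · exact ⟨hpos, by rw [roleProb]; linarith⟩
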